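/- For $n\ge 1$ let $B_n$ be the standard braid group on $n$ strings, with generators $\sigma_1,\dots,\sigma_{n-1}$ and relations $\sigma_i\sigma_{i+1}\sigma_i=\sigma_{i+1}\sigma_i\sigma_{i+1}$ and $\sigma_i\sigma_j=\sigma_j\sigma_i$ for $|i-j|\ge 2$. The irreducible length of a braid $\beta\in B_n$ is the least number of letters $\sigma_i^{\pm1}$ in a word that represents $\beta$. Let $\Omega^{(1)}(n,\mu)$ be the number of ambient isotopy classes of knots and links in $\mathbb R^3$ that are closures of braids in $B_n$ of irreducible length $\mu$. Then, for all sufficiently large $n$ and $\mu$, this number is finite and $$\Omega^{(1)}(n,\mu)<\frac{32\pi^2}{\ln^4 2}\,\frac{2^n}{n^3}\,7^{\mu-1};$$ that is, there are $N$ and $M$ such that this holds for all $n\ge N$ and all $\mu\ge M$. -/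

import Mathlib

noncomputable section

/-- Three-dimensional Euclidean space. -/
abbrev Space3 : Type := EuclideanSpace ℝ (Fin 3)

/-- Two subsets of `ℝ³` are ambient isotopic: some continuous family of self-homeomorphisms of
`ℝ³`, starting at the identity, carries the first set onto the second one. -/
def AmbientIsotopic (A B : Set Space3) : Prop :=
  ∃ Φ : unitInterval → (Space3 ≃ₜ Space3),
    Continuous (fun p : unitInterval × Space3 => Φ p.1 p.2) ∧
    (∀ x, Φ 0 x = x) ∧ Φ 1 '' A = B

theorem AmbientIsotopic.refl (A : Set Space3) : AmbientIsotopic A A :=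
  ⟨fun _ => Homeomorph.refl _, continuous_snd, fun _ => rfl, by simp⟩

theorem AmbientIsotopic.symm {A B : Set Space3} (h : AmbientIsotopic A B) :
    AmbientIsotopic B A := by
  obtain ⟨Φ, hc, h0, rfl⟩ := h
  refine ⟨fun t => (Φ 1).symm.trans (Φ (unitInterval.symm t)), ?_, ?_, ?_⟩
  · exact hc.comp ((unitInterval.continuous_symm.comp continuous_fst).prodMk
      ((Φ 1).symm.continuous.comp continuous_snd))
  · intro x
    simp
  · ext x
    simp [h0]

theorem AmbientIsotopic.trans {A B C : Set Space3} (h₁ : AmbientIsotopic A B)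
    (h₂ : AmbientIsotopic B C) : AmbientIsotopic A C := by
  obtain ⟨Φ, hc, h0, rfl⟩ := h₁
  obtain ⟨Ψ, hd, k0, rfl⟩ := h₂
  refine ⟨fun t => (Φ t).trans (Ψ t), ?_, ?_, ?_⟩
  · exact hd.comp (continuous_fst.prodMk hc)
  · intro x
    simp [h0, k0]
  · rw [Set.image_image]
    rfl

/-- Ambient isotopy as an equivalence relation on the subsets of `ℝ³`. -/
def ambientIsotopySetoid : Setoid (Set Space3) where
  r := AmbientIsotopic
  iseqv := ⟨AmbientIsotopic.refl, AmbientIsotopic.symm, AmbientIsotopic.trans⟩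

/-- Ambient isotopy classes of subsets of `ℝ³`; the class of a link is its link type. -/
def IsotopyClass : Type := Quotient ambientIsotopySetoid

/-- The defining relators of the braid group on `n` strings, in the `n - 1` generators
`σ_0, …, σ_{n-2}`. -/
def braidRelators (n : ℕ) : Set (FreeGroup (Fin (n - 1))) :=
  {r | (∃ i j : Fin (n - 1), (i : ℕ) + 1 = j ∧
          r = .of i * .of j * .of i * (.of j * .of i * .of j)⁻¹) ∨
       (∃ i j : Fin (n - 1), (i : ℕ) + 2 ≤ j ∧
          r = .of i * .of j * (.of j * .of i)⁻¹)}

/-- The standard braid group on `n` strings. -/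
abbrev BraidGroup (n : ℕ) : Type := PresentedGroup (braidRelators n)

/-- Words in the letters `σ_i = (i, true)` and `σ_i⁻¹ = (i, false)`. -/
abbrev BraidWord (n : ℕ) : Type := List (Fin (n - 1) × Bool)

/-- The element of the braid group represented by a word. -/
def BraidWord.toBraid {n : ℕ} (w : BraidWord n) : BraidGroup n :=
  PresentedGroup.mk (braidRelators n) (FreeGroup.mk w)

/-- The irreducible (primitive) length of a braid: the least number of letters in a word that
represents it. -/
def irreducibleLength {n : ℕ} (β : BraidGroup n) : ℕ :=
  sInf {N : ℕ | ∃ w : BraidWord n, w.toBraid = β ∧ w.length = N}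

/-- The position in the plane, at time `u ∈ [0, 1]`, of the string that starts at the point `j` of
the real axis. For the letter `σ_i` or `σ_i⁻¹` the strings starting at `i` and `i + 1` exchange
their places by a half turn (counterclockwise or clockwise) around `i + 1/2`, and the other strings
are at rest; for `none` all strings are at rest. -/
def stringPosition {n : ℕ} : Option (Fin (n - 1) × Bool) → ℕ → ℝ → ℂ
  | none, j, _ => j
  | some (i, b), j, u =>
    let e : ℂ := Complex.exp ((if b then 1 else -1) * Real.pi * u * Complex.I)
    if j = (i : ℕ) then ((i : ℕ) : ℂ) + 1 / 2 - e / 2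
    else if j = (i : ℕ) + 1 then ((i : ℕ) : ℂ) + 1 / 2 + e / 2
    else j

/-- The half plane `-1 < Re z`, turned around the third coordinate axis of `ℝ³` to the
angle `2πt`. -/
def pagePoint (z : ℂ) (t : ℝ) : Space3 :=
  !₂[(1 + z.re) * Real.cos (2 * Real.pi * t), (1 + z.re) * Real.sin (2 * Real.pi * t), z.im]

/-- The closure of the geometric braid on `n` strings given by a word of `N` letters. The full turn
around the axis is divided into `N + 1` equal sectors. The `k`-th sector contains the crossing of
the `k`-th letter; the last one contains the arcs that join the two ends of the braid. -/
def closedBraid {n : ℕ} (w : BraidWord n) : Set Space3 :=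
  {x | ∃ k ≤ w.length, ∃ j < n, ∃ u ∈ Set.Icc (0 : ℝ) 1,
    x = pagePoint (stringPosition w[k]? j u) ((k + u) / (w.length + 1))}

/-- The set of all link types (knots included) of closures of braids on `n` strings of irreducible
length `μ`. -/
def closedBraidTypes (n μ : ℕ) : Set IsotopyClass :=
  {K | ∃ w : BraidWord n, irreducibleLength w.toBraid = μ ∧
    K = Quotient.mk ambientIsotopySetoid (closedBraid w)}

end

/-! Two independent facts are combined: the link type of a closure depends only on the braid, and
every braid has a shortest word of a restricted shape, of which there are few.

Counting. Among the shortest words of a braid, one of least `wordWeight` has no cancelling pair, no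
descent of the index by two or more (the letters would commute), and no factor of the form σ_{i+1}
σ_i σ_{i+1} with equal signs (the braid relation would lower it); see `exists_isNormalWord`. To
count such words, give the letter of index i the weight 2^{-i}. The admissible successors of a
letter have total weight at most 4 + 1 + 2 = 7 times its own, coming from the index below, the same
index and the higher indices. The forbidden triple removes one unit from 7 · 7, so two further
letters cost a factor 48 and not 49 (`sum_sum_half_pow_le`). This gives O(2^n · 48^{μ/2}) words. The
gain (48/49)^{μ/2} over 7^μ absorbs n^{-3} once μ exceeds a multiple of log n; for smaller μ the
trivial bound (2n)^μ is already below 2^n / n^3. Hence a lower bound on n alone is enough, apart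
from μ ≥ 1.

Topology. A closed braid is swept out by a loop of n-point configurations in a half plane that turns
around an axis. Two uniformly close loops have ambient isotopic closures: a small vector field on
each page pushes one configuration to the other, and identity plus a contraction is bijective. So
the isotopy class is locally constant along a homotopy of loops, hence constant
(`ambientIsotopic_of_homotopic`).

It remains to see that words of the same braid give homotopic loops, that is, that the half turns
satisfy the braid relations in the fundamental group of the configuration space. Straight-line
homotopies do this: both sides of a relation deform to one common motion, two simultaneous half
turns or the rigid half turn of three points. No collision occurs because corresponding difference
vectors always lie in a common open half plane (`IsTrackOf.exists_homotopic`). -/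

/-! ### Counting normal words. -/

/-- The pair of consecutive letters is neither a cancelling pair nor a descent by at least two. -/
def StepOK {m : ℕ} (x y : Fin m × Bool) : Prop :=
  (x.1 : ℕ) ≤ y.1 + 1 ∧ (x.1 = y.1 → x.2 = y.2)

instance StepOK.instDecidable {m : ℕ} (x y : Fin m × Bool) : Decidable (StepOK x y) :=
  inferInstanceAs (Decidable (_ ∧ _))

/-- The three letters are `σ_{i+1}, σ_i, σ_{i+1}` with equal signs. -/
def IsPeak {m : ℕ} (x y z : Fin m × Bool) : Prop :=
  z = x ∧ (x.1 : ℕ) = y.1 + 1 ∧ x.2 = y.2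

instance IsPeak.instDecidable {m : ℕ} (x y z : Fin m × Bool) : Decidable (IsPeak x y z) :=
  inferInstanceAs (Decidable (_ ∧ _))

/-- A word none of whose factors can be shortened by a cancellation, or lowered by a commutation
or by a braid relation. -/
def IsNormalWord {m : ℕ} (w : List (Fin m × Bool)) : Prop :=
  (∀ u x y v, w = u ++ x :: y :: v → StepOK x y) ∧
    ∀ u x y z v, w = u ++ x :: y :: z :: v → ¬ IsPeak x y z

theorem IsNormalWord.tail {m : ℕ} {x : Fin m × Bool} {w : List (Fin m × Bool)}
    (h : IsNormalWord (x :: w)) : IsNormalWord w :=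
  ⟨fun u a b v e => h.1 (x :: u) a b v (by rw [e]; rfl),
    fun u a b c v e => h.2 (x :: u) a b c v (by rw [e]; rfl)⟩

/-- A finite set that contains all words of length `k` which extend the letter `x` to a normal
word. -/
def normalTails {m : ℕ} : ℕ → Fin m × Bool → Finset (List (Fin m × Bool))
  | 0, _ => {[]}
  | k + 1, x => (Finset.univ.filter (StepOK x)).biUnion fun y =>
      ((normalTails k y).filter fun l => ∀ z ∈ l.head?, ¬ IsPeak x y z).image (List.cons y)

theorem IsNormalWord.mem_normalTails {m : ℕ} {w : List (Fin m × Bool)} :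
    ∀ {x : Fin m × Bool}, IsNormalWord (x :: w) → w ∈ normalTails w.length x := by
  induction w with
  | nil => intro x _; simp [normalTails]
  | cons y l ih =>
    intro x h
    simp only [List.length_cons, normalTails, Finset.mem_biUnion, Finset.mem_filter,
      Finset.mem_univ, true_and, Finset.mem_image]
    refine ⟨y, h.1 [] x y l rfl, l, ⟨ih h.tail, ?_⟩, rfl⟩
    intro z hz
    cases l with
    | nil => simp at hz
    | cons z' l =>
      simp only [List.head?_cons, Option.mem_def, Option.some.injEq] at hz
      subst hz
      exact h.2 [] x y z' l rfl

/-- In units of the weight of `x`, the index below gives two letters of weight 2, the same index one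
letter of weight 1, and all higher indices at most 2 · (1/2 + 1/4 + …) = 2. For index 0 there is no
lower letter, which leaves 3. -/
theorem sum_half_pow_stepOK_le {m : ℕ} (x : Fin m × Bool) :
    ∑ y with StepOK x y, (1 / 2 : ℝ) ^ (y.1 : ℕ) ≤
      (if (x.1 : ℕ) = 0 then 3 else 7) * (1 / 2) ^ (x.1 : ℕ) := by
  obtain ⟨i, b⟩ := x
  have h1 : ∑ y with StepOK (i, b) y, (1 / 2 : ℝ) ^ (y.1 : ℕ) =
      ∑ j ∈ Finset.range m, ((if j + 1 = i then 2 * (1 / 2 : ℝ) ^ j else 0) +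
        (if j = i then (1 / 2 : ℝ) ^ j else 0) + if (i : ℕ) < j then 2 * (1 / 2 : ℝ) ^ j else 0) := by
    rw [Finset.sum_filter, Fintype.sum_prod_type, Finset.sum_range]
    refine Finset.sum_congr rfl fun j _ => ?_
    simp only [Fintype.sum_bool, StepOK, Fin.ext_iff]
    rcases lt_trichotomy ((j : ℕ) + 1) i with h | h | h
    · have h1 : ¬ (i : ℕ) ≤ j + 1 := by omega
      have h2 : ¬ (j : ℕ) + 1 = i := by omega
      have h3 : ¬ (j : ℕ) = i := by omega
      have h4 : ¬ (i : ℕ) < j := by omega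
      simp [h1, h2, h3, h4]
    · have h1 : (i : ℕ) ≤ j + 1 := by omega
      have h3 : ¬ (j : ℕ) = i := by omega
      have h5 : ¬ (i : ℕ) = j := by omega
      have h4 : ¬ (i : ℕ) < j := by omega
      simp only [h, h3, h4, h5]
      simp
      ring
    · rcases (show (j : ℕ) = i ∨ (i : ℕ) < j by omega) with h' | h'
      · rw [h']
        cases b <;> simp
      · have h1 : (i : ℕ) ≤ j + 1 := by omega
        have h2 : ¬ (j : ℕ) + 1 = i := by omega
        have h3 : ¬ (j : ℕ) = i := by omega
        have h5 : ¬ (i : ℕ) = j := by omega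
        simp only [h1, h2, h3, h', h5]
        simp
        ring
  have h2 : ∑ j ∈ Finset.range m, (if j + 1 = (i : ℕ) then 2 * (1 / 2 : ℝ) ^ j else 0) ≤
      (if (i : ℕ) = 0 then 0 else 4) * (1 / 2) ^ (i : ℕ) := by
    rcases Nat.eq_zero_or_pos (i : ℕ) with h | h
    · simp [h]
    · obtain ⟨k, hk⟩ : ∃ k, (i : ℕ) = k + 1 := ⟨i - 1, by omega⟩
      have := i.2
      have hk' : k < m := by omega
      simp only [hk, Nat.add_right_cancel_iff, Finset.sum_ite_eq', Finset.mem_range, hk', if_true]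
      rw [if_neg (by omega), pow_succ]
      linarith
  have h3 : ∑ j ∈ Finset.range m, (if j = (i : ℕ) then (1 / 2 : ℝ) ^ j else 0) =
      (1 / 2) ^ (i : ℕ) := by
    simp
  have h4 : ∑ j ∈ Finset.range m, (if (i : ℕ) < j then 2 * (1 / 2 : ℝ) ^ j else 0) ≤
      2 * (1 / 2) ^ (i : ℕ) := by
    -- The range is enlarged so that the nonzero terms, shifted by `i + 1`, form a full geometric
    -- sum.
    calc _ ≤ ∑ j ∈ Finset.range (i + 1 + m), (if (i : ℕ) < j then 2 * (1 / 2 : ℝ) ^ j else 0) :=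
          Finset.sum_le_sum_of_subset_of_nonneg (Finset.range_mono (by omega))
            fun j _ _ => by split_ifs <;> positivity
      _ = (1 / 2) ^ (i : ℕ) * ∑ j ∈ Finset.range m, (1 / 2 : ℝ) ^ j := by
          rw [Finset.sum_range_add, Finset.sum_eq_zero, zero_add, Finset.mul_sum]
          · refine Finset.sum_congr rfl fun j _ => ?_
            rw [if_pos (by omega), pow_add, pow_succ]
            ring
          · intro j hj
            rw [if_neg (by simp at hj; omega)]
      _ ≤ (1 / 2) ^ (i : ℕ) * 2 := by
          gcongr
          exact sum_geometric_two_le m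
      _ = _ := by ring
  rw [h1, Finset.sum_add_distrib, Finset.sum_add_distrib, h3]
  dsimp only
  split_ifs at h2 ⊢ <;> linarith

theorem card_normalTails_succ_le {m : ℕ} (k : ℕ) (x : Fin m × Bool) :
    (normalTails (k + 1) x).card ≤ ∑ y with StepOK x y, (normalTails k y).card := by
  refine Finset.card_biUnion_le.trans (Finset.sum_le_sum fun y _ => ?_)
  exact Finset.card_image_le.trans (Finset.card_filter_le _ _)

theorem card_normalTails_add_two_le {m : ℕ} (k : ℕ) (x : Fin m × Bool) :
    (normalTails (k + 2) x).card ≤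
      ∑ y with StepOK x y, ∑ z with StepOK y z ∧ ¬ IsPeak x y z, (normalTails k z).card := by
  refine Finset.card_biUnion_le.trans (Finset.sum_le_sum fun y _ => ?_)
  refine Finset.card_image_le.trans ?_
  refine (Finset.card_le_card (t := (Finset.univ.filter
    fun z => StepOK y z ∧ ¬ IsPeak x y z).biUnion
      fun z => (normalTails k z).image (List.cons z)) ?_).trans ?_
  · intro l hl
    simp only [normalTails, Finset.mem_filter, Finset.mem_biUnion, Finset.mem_univ, true_and,
      Finset.mem_image] at hl ⊢
    obtain ⟨⟨z, hz, l', ⟨hl', -⟩, rfl⟩, h⟩ := hl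
    exact ⟨z, ⟨hz, h z (by simp)⟩, l', hl', rfl⟩
  · exact Finset.card_biUnion_le.trans (Finset.sum_le_sum fun z _ => Finset.card_image_le)

/-- Two steps cost at most 7 · 7 = 49, and the excluded peak returning to `x` saves exactly the
weight of `x`. At index 0 no peak starts, but there 3 · 7 = 21 is small enough. -/
theorem sum_sum_half_pow_le {m : ℕ} (x : Fin m × Bool) :
    ∑ y with StepOK x y, ∑ z with StepOK y z ∧ ¬ IsPeak x y z, (1 / 2 : ℝ) ^ (z.1 : ℕ) ≤
      48 * (1 / 2) ^ (x.1 : ℕ) := by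
  have hle (y : Fin m × Bool) : ∑ z with StepOK y z ∧ ¬ IsPeak x y z, (1 / 2 : ℝ) ^ (z.1 : ℕ) ≤
      ∑ z with StepOK y z, (1 / 2 : ℝ) ^ (z.1 : ℕ) :=
    Finset.sum_le_sum_of_subset_of_nonneg
      (fun z hz => by simp only [Finset.mem_filter] at hz ⊢; exact ⟨hz.1, hz.2.1⟩)
      fun _ _ _ => by positivity
  have h7 (y : Fin m × Bool) : ∑ z with StepOK y z, (1 / 2 : ℝ) ^ (z.1 : ℕ) ≤
      7 * (1 / 2) ^ (y.1 : ℕ) := by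
    refine (sum_half_pow_stepOK_le y).trans ?_
    gcongr
    split_ifs <;> norm_num
  have hx := sum_half_pow_stepOK_le x
  have hpos : (0 : ℝ) < (1 / 2) ^ (x.1 : ℕ) := by positivity
  by_cases h0 : (x.1 : ℕ) = 0
  · rw [if_pos h0] at hx
    calc _ ≤ ∑ y with StepOK x y, 7 * (1 / 2 : ℝ) ^ (y.1 : ℕ) :=
          Finset.sum_le_sum fun y _ => (hle y).trans (h7 y)
      _ ≤ _ := by
          rw [← Finset.mul_sum]
          linarith
  · rw [if_neg h0] at hx
    -- The middle letter of the only peak that starts with `x`: one index lower, with the same sign.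
    let y₀ : Fin m × Bool := (⟨x.1 - 1, by omega⟩, x.2)
    have hy₀ : (x.1 : ℕ) = y₀.1 + 1 := by simp only [y₀]; omega
    have hne : x.1 ≠ y₀.1 := fun h => by rw [← h] at hy₀; omega
    have hpeak : IsPeak x y₀ x := ⟨rfl, hy₀, rfl⟩
    have hy₀ok : StepOK x y₀ := ⟨by omega, fun h => absurd h hne⟩
    have hxok : StepOK y₀ x := ⟨by omega, fun h => absurd h.symm hne⟩
    have hle₀ : ∑ z with StepOK y₀ z ∧ ¬ IsPeak x y₀ z, (1 / 2 : ℝ) ^ (z.1 : ℕ) +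
        (1 / 2) ^ (x.1 : ℕ) ≤ ∑ z with StepOK y₀ z, (1 / 2 : ℝ) ^ (z.1 : ℕ) := by
      rw [← Finset.sum_erase_add (Finset.univ.filter (StepOK y₀)) _ (a := x) (by simpa using hxok)]
      refine add_le_add (Finset.sum_le_sum_of_subset_of_nonneg (fun z hz => ?_)
        fun _ _ _ => by positivity) le_rfl
      simp only [Finset.mem_filter, Finset.mem_univ, true_and, Finset.mem_erase] at hz ⊢
      exact ⟨fun h => hz.2 (h ▸ hpeak), hz.1⟩
    calc _ ≤ ∑ y with StepOK x y, (7 * (1 / 2 : ℝ) ^ (y.1 : ℕ) -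
          if y = y₀ then (1 / 2 : ℝ) ^ (x.1 : ℕ) else 0) := by
          refine Finset.sum_le_sum fun y _ => ?_
          split_ifs with h
          · rw [h]
            linarith [h7 y₀]
          · linarith [hle y, h7 y]
      _ ≤ _ := by
          rw [Finset.sum_sub_distrib, ← Finset.mul_sum, Finset.sum_ite_eq',
            if_pos (by simpa using hy₀ok)]
          linarith

/-- Induction in steps of two letters, since the saving needs three consecutive letters. The factor
`2 ^ m` makes the bound at least 1 for the empty tail, because `x.1 < m`. -/
theorem card_normalTails_le {m : ℕ} : ∀ (k : ℕ) (x : Fin m × Bool),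
    ((normalTails k x).card : ℝ) ≤ 7 ^ (k % 2) * 48 ^ (k / 2) * 2 ^ m * (1 / 2) ^ (x.1 : ℕ)
  | 0, x => by
    have : (1 / 2 : ℝ) ^ m ≤ (1 / 2) ^ (x.1 : ℕ) :=
      pow_le_pow_of_le_one (by norm_num) (by norm_num) x.1.2.le
    calc ((normalTails 0 x).card : ℝ) = 2 ^ m * (1 / 2) ^ m := by
          rw [← mul_pow]; simp [normalTails]
      _ ≤ 2 ^ m * (1 / 2) ^ (x.1 : ℕ) := by gcongr
      _ = _ := by simp
  | 1, x => by
    have h : ((normalTails 1 x).card : ℝ) ≤ ∑ y with StepOK x y, ((normalTails 0 y).card : ℝ) := by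
      exact_mod_cast card_normalTails_succ_le 0 x
    calc _ ≤ _ := h
      _ ≤ ∑ y with StepOK x y, 2 ^ m * (1 / 2 : ℝ) ^ (y.1 : ℕ) :=
          Finset.sum_le_sum fun y _ => by simpa using card_normalTails_le 0 y
      _ ≤ 2 ^ m * ((if (x.1 : ℕ) = 0 then 3 else 7) * (1 / 2) ^ (x.1 : ℕ)) := by
          rw [← Finset.mul_sum]
          gcongr
          exact sum_half_pow_stepOK_le x
      _ ≤ 2 ^ m * (7 * (1 / 2) ^ (x.1 : ℕ)) := by
          gcongr
          split_ifs <;> norm_num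
      _ = _ := by norm_num; ring
  | k + 2, x => by
    have h : ((normalTails (k + 2) x).card : ℝ) ≤ ∑ y with StepOK x y,
        ∑ z with StepOK y z ∧ ¬ IsPeak x y z, ((normalTails k z).card : ℝ) := by
      exact_mod_cast card_normalTails_add_two_le k x
    calc _ ≤ _ := h
      _ ≤ ∑ y with StepOK x y, ∑ z with StepOK y z ∧ ¬ IsPeak x y z,
          7 ^ (k % 2) * 48 ^ (k / 2) * 2 ^ m * (1 / 2 : ℝ) ^ (z.1 : ℕ) :=
          Finset.sum_le_sum fun y _ => Finset.sum_le_sum fun z _ => card_normalTails_le k z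
      _ ≤ 7 ^ (k % 2) * 48 ^ (k / 2) * 2 ^ m * (48 * (1 / 2) ^ (x.1 : ℕ)) := by
          simp only [← Finset.mul_sum]
          gcongr
          exact sum_sum_half_pow_le x
      _ = _ := by
          rw [Nat.add_mod_right, Nat.add_div_right k (by norm_num), pow_succ]
          ring

/-- A finite set that contains all normal words of length `k + 1`. -/
def normalWords (m k : ℕ) : Finset (List (Fin m × Bool)) :=
  Finset.univ.biUnion fun x => (normalTails k x).image (List.cons x)

theorem IsNormalWord.mem_normalWords {m k : ℕ} {w : List (Fin m × Bool)} (h : IsNormalWord w)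
    (hk : w.length = k + 1) : w ∈ normalWords m k := by
  obtain ⟨x, l, rfl⟩ := List.exists_cons_of_length_eq_add_one hk
  simp only [List.length_cons, Nat.add_right_cancel_iff] at hk
  simp only [normalWords, Finset.mem_biUnion, Finset.mem_univ, true_and, Finset.mem_image]
  exact ⟨x, l, hk ▸ h.mem_normalTails, rfl⟩

theorem card_normalWords_le (m k : ℕ) :
    ((normalWords m k).card : ℝ) ≤ 2 * 2 ^ (m + 1) * (7 ^ (k % 2) * 48 ^ (k / 2)) := by
  have h : ((normalWords m k).card : ℝ) ≤ ∑ x : Fin m × Bool, ((normalTails k x).card : ℝ) := by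
    exact_mod_cast Finset.card_biUnion_le.trans (Finset.sum_le_sum fun x _ => Finset.card_image_le)
  calc _ ≤ _ := h
    _ ≤ ∑ x : Fin m × Bool, 7 ^ (k % 2) * 48 ^ (k / 2) * 2 ^ m * (1 / 2 : ℝ) ^ (x.1 : ℕ) :=
        Finset.sum_le_sum fun x _ => card_normalTails_le k x
    _ = 7 ^ (k % 2) * 48 ^ (k / 2) * 2 ^ m * (2 * ∑ j ∈ Finset.range m, (1 / 2 : ℝ) ^ j) := by
        rw [← Finset.mul_sum, Fintype.sum_prod_type, Finset.sum_range]
        simp only [Finset.sum_const, Finset.card_univ, Fintype.card_bool, nsmul_eq_mul,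
          Nat.cast_ofNat, ← Finset.mul_sum]
    _ ≤ 7 ^ (k % 2) * 48 ^ (k / 2) * 2 ^ m * (2 * 2) := by
        gcongr
        exact sum_geometric_two_le m
    _ = _ := by ring

/-! ### Comparison of the counts with the claimed bound. -/

/-- The logarithm of (2n)^{k+1} ≤ 2^n / n^3 when k + 1 ≤ 294 log n + 2. -/
theorem eventually_polylog_le :
    ∀ᶠ n : ℕ in Filter.atTop, (294 * Real.log n + 2) * (Real.log 2 + Real.log n) +
      3 * Real.log n ≤ n * Real.log 2 := by
  have hlog2 : 0 < Real.log 2 := Real.log_pos (by norm_num)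
  have h := (Real.isLittleO_pow_log_id_atTop (n := 2)).comp_tendsto tendsto_natCast_atTop_atTop
  -- With log 2 < 1 ≤ log n the left side is at most (294 + 299 + 2) log² n, hence 595.
  have hb := h.bound (show (0 : ℝ) < Real.log 2 / 595 by positivity)
  have hL := (Real.tendsto_log_atTop.comp tendsto_natCast_atTop_atTop).eventually_ge_atTop (1 : ℝ)
  filter_upwards [hb, hL] with n h1 h2
  simp only [Function.comp_apply, id_eq, norm_pow, Real.norm_eq_abs, sq_abs, Nat.abs_cast] at h1 h2
  have h3 : Real.log 2 < 1 := by linarith [Real.log_two_lt_d9]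
  have h4 : 595 * Real.log n ^ 2 ≤ n * Real.log 2 := by
    have : 595 * (Real.log 2 / 595 * n) = n * Real.log 2 := by ring
    linarith
  nlinarith

/-- Both bounds on the number of normal words together are eventually smaller than
`288 · 2ⁿ / n³ · 7ᵏ`. -/
theorem eventually_lt_of_le_of_le :
    ∃ N : ℕ, ∀ n k : ℕ, N ≤ n → ∀ c : ℝ, c ≤ 2 * 2 ^ n * (7 ^ (k % 2) * 48 ^ (k / 2)) →
      c ≤ (2 * n) ^ (k + 1) → c < 288 * (2 ^ n / n ^ 3) * 7 ^ k := by
  obtain ⟨N, hN⟩ := Filter.eventually_atTop.1 eventually_polylog_le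
  refine ⟨max N 1, fun n k hn c h1 h2 => ?_⟩
  have hn1 : 1 ≤ n := (le_max_right _ _).trans hn
  have hn0 : (0 : ℝ) < n := by exact_mod_cast hn1
  have h7 : (7 : ℝ) ^ k = 7 ^ (k % 2) * 49 ^ (k / 2) := by
    conv_lhs => rw [← Nat.mod_add_div k 2, pow_add, pow_mul]
    norm_num
  -- The case distinction is whether k is large compared with log n, so that the gain (49/48)^{k/2}
  -- covers n^3.
  by_cases hc : (n : ℝ) ^ 3 ≤ (49 / 48) ^ (k / 2)
  · have h8 : (48 : ℝ) ^ (k / 2) ≤ 49 ^ (k / 2) / n ^ 3 := by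
      rw [le_div_iff₀ (by positivity)]
      calc (48 : ℝ) ^ (k / 2) * n ^ 3 ≤ 48 ^ (k / 2) * (49 / 48) ^ (k / 2) := by gcongr
        _ = _ := by rw [← mul_pow]; norm_num
    calc c ≤ _ := h1
      _ ≤ 2 * 2 ^ n * (7 ^ (k % 2) * (49 ^ (k / 2) / n ^ 3)) := by gcongr
      _ = 2 * (2 ^ n / n ^ 3) * 7 ^ k := by rw [h7]; ring
      _ < _ := by gcongr; norm_num
  -- 147 = 3 · 49, from log (49/48) ≥ 1/49.
  · have hq : ((k / 2 : ℕ) : ℝ) ≤ 147 * Real.log n := by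
      have h9 := Real.log_lt_log (by positivity) (not_le.1 hc)
      rw [Real.log_pow, Real.log_pow] at h9
      have h10 : 1 / 49 ≤ Real.log (49 / 48) := by
        have := Real.one_sub_inv_le_log_of_pos (show (0 : ℝ) < 49 / 48 by norm_num)
        norm_num at this ⊢
        linarith
      have h11 : (0 : ℝ) ≤ (k / 2 : ℕ) := by positivity
      push_cast at h9
      nlinarith
    have hk : ((k + 1 : ℕ) : ℝ) ≤ 294 * Real.log n + 2 := by
      have : k + 1 ≤ 2 * (k / 2) + 2 := by omega
      have : ((k + 1 : ℕ) : ℝ) ≤ 2 * (k / 2 : ℕ) + 2 := by exact_mod_cast this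
      linarith
    have hlog : 0 ≤ Real.log 2 + Real.log n :=
      add_nonneg (Real.log_nonneg (by norm_num)) (Real.log_nonneg (by exact_mod_cast hn1))
    have hfin : (2 * n : ℝ) ^ (k + 1) ≤ 2 ^ n / n ^ 3 := by
      rw [← Real.log_le_log_iff (by positivity) (by positivity), Real.log_pow,
        Real.log_div (by positivity) (by positivity), Real.log_pow, Real.log_pow,
        Real.log_mul (by norm_num) hn0.ne']
      have := hN n ((le_max_left _ _).trans hn)
      have h12 := mul_le_mul_of_nonneg_right hk hlog
      push_cast at h12 ⊢
      linarith
    calc c ≤ _ := h2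
      _ ≤ 2 ^ n / n ^ 3 := hfin
      _ < 288 * (2 ^ n / n ^ 3) := by
          have : (0 : ℝ) < 2 ^ n / n ^ 3 := by positivity
          linarith
      _ ≤ _ := le_mul_of_one_le_right (by positivity) (one_le_pow₀ (by norm_num))

/-! ### Reduction of braids to normal words. -/

/-- A weighted sum of the indices of a word, which decreases when the word becomes smaller in the
lexicographic order of its indices. -/
def wordWeight {m : ℕ} : List (Fin m × Bool) → ℕ
  | [] => 0
  | x :: l => x.1 * (l.length + 1) + wordWeight l

theorem wordWeight_append_lt {m : ℕ} (u : List (Fin m × Bool)) {v w : List (Fin m × Bool)}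
    (hl : v.length = w.length) (h : wordWeight v < wordWeight w) :
    wordWeight (u ++ v) < wordWeight (u ++ w) := by
  induction u with
  | nil => exact h
  | cons x u ih =>
    simp only [List.cons_append, wordWeight, List.length_append, hl]
    omega

theorem BraidWord.toBraid_append {n : ℕ} (u v : BraidWord n) :
    BraidWord.toBraid (u ++ v : BraidWord n) = u.toBraid * v.toBraid := by
  simp only [BraidWord.toBraid, ← map_mul, FreeGroup.mul_mk]

theorem toBraid_mk_singleton {n : ℕ} (i : Fin (n - 1)) (b : Bool) :
    BraidWord.toBraid ([(i, b)] : BraidWord n) =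
      (PresentedGroup.of i : BraidGroup n) ^ (if b then 1 else -1 : ℤ) := by
  cases b
  · simp only [Bool.false_eq_true, if_false, zpow_neg, zpow_one]
    rfl
  · simp only [if_true, zpow_one]
    rfl

theorem braid_relation {n : ℕ} (i j : Fin (n - 1)) (h : (i : ℕ) + 1 = j) :
    (PresentedGroup.of i : BraidGroup n) * PresentedGroup.of j * PresentedGroup.of i =
      PresentedGroup.of j * PresentedGroup.of i * PresentedGroup.of j := by
  have := PresentedGroup.one_of_mem (rels := braidRelators n) (Or.inl ⟨i, j, h, rfl⟩)
  rw [map_mul, map_inv, mul_inv_eq_one] at this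
  rw [map_mul, map_mul, map_mul, map_mul] at this
  exact this

theorem commute_relation {n : ℕ} (i j : Fin (n - 1)) (h : (i : ℕ) + 2 ≤ j) :
    Commute (PresentedGroup.of i : BraidGroup n) (PresentedGroup.of j) := by
  have := PresentedGroup.one_of_mem (rels := braidRelators n) (Or.inr ⟨i, j, h, rfl⟩)
  rw [map_mul, map_inv, mul_inv_eq_one] at this
  rw [map_mul, map_mul] at this
  exact this

theorem toBraid_append_append {n : ℕ} {v v' : BraidWord n} (u t : BraidWord n)
    (h : v.toBraid = v'.toBraid) :
    BraidWord.toBraid (u ++ (v ++ t) : BraidWord n) =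
      BraidWord.toBraid (u ++ (v' ++ t) : BraidWord n) := by
  simp only [BraidWord.toBraid_append, h]

/-- Every braid is represented by a normal word whose length is the irreducible length. -/
theorem exists_isNormalWord {n : ℕ} (w : BraidWord n) :
    ∃ w' : BraidWord n, w'.toBraid = w.toBraid ∧ w'.length = irreducibleLength w.toBraid ∧
      IsNormalWord w' := by
  let S : Set (BraidWord n) :=
    {v | v.toBraid = w.toBraid ∧ v.length = irreducibleLength w.toBraid}
  have hne : S.Nonempty :=
    Nat.sInf_mem (s := {N : ℕ | ∃ v : BraidWord n, v.toBraid = w.toBraid ∧ v.length = N})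
      ⟨_, w, rfl, rfl⟩
  obtain ⟨hv, hlen⟩ : Function.argminOn wordWeight S hne ∈ S := Function.argminOn_mem _ _ _
  have hmin : ∀ v' ∈ S, ¬ wordWeight v' < wordWeight (Function.argminOn wordWeight S hne) :=
    fun v' h => Function.not_lt_argminOn wordWeight S h
  generalize Function.argminOn wordWeight S hne = v at hv hlen hmin
  -- By minimality, no factor can be exchanged for another one of the same braid and length that
  -- lowers the weight.
  have key : ∀ u r r' t : BraidWord n, v = u ++ (r ++ t) → r'.toBraid = r.toBraid →
      r'.length = r.length → ¬ wordWeight (r' ++ t) < wordWeight (r ++ t) := by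
    intro u r r' t e hb hl hw
    refine hmin (u ++ (r' ++ t)) ⟨?_, ?_⟩ ?_
    · rw [toBraid_append_append u t hb, ← e, hv]
    · rw [← hlen, e]
      simp [hl]
    · rw [e]
      exact wordWeight_append_lt u (by simp [hl]) hw
  refine ⟨v, hv, hlen, ?_, ?_⟩
  · rintro u ⟨i, b⟩ ⟨j, c⟩ t e
    refine ⟨?_, ?_⟩
    -- A descent by at least two consists of commuting letters, and the exchange lowers the weight.
    · by_contra hij
      refine key u [(i, b), (j, c)] [(j, c), (i, b)] t e ?_ rfl ?_
      · rw [← List.singleton_append, BraidWord.toBraid_append, ← List.singleton_append (l := [(j, c)]),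
          BraidWord.toBraid_append]
        simp only [toBraid_mk_singleton]
        exact (commute_relation j i (by simp at hij; omega)).zpow_zpow _ _
      · simp only [List.cons_append, List.nil_append, wordWeight, List.length_cons] at hij ⊢
        nlinarith
    · rintro ⟨⟩
      -- Equal indices with opposite signs cancel, which contradicts the minimal length rather than
      -- the minimal weight.
      by_contra hbc
      have h1 : BraidWord.toBraid (u ++ t : BraidWord n) = BraidWord.toBraid v := by
        have h2 : BraidWord.toBraid ([(i, b), (i, c)] : BraidWord n) = 1 := by
          rw [← List.singleton_append, BraidWord.toBraid_append]
          simp only [toBraid_mk_singleton]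
          cases b <;> cases c <;> simp_all
        have h3 : v = u ++ ([(i, b), (i, c)] ++ t) := e
        rw [h3, BraidWord.toBraid_append, BraidWord.toBraid_append, BraidWord.toBraid_append, h2,
          one_mul]
      have h4 : irreducibleLength w.toBraid ≤ (u ++ t).length :=
        Nat.sInf_le ⟨u ++ t, h1.trans hv, rfl⟩
      rw [← hlen, e] at h4
      simp at h4
  · rintro u ⟨i, b⟩ ⟨j, c⟩ z t e ⟨rfl, hij, hbc⟩
    simp only at hij hbc
    subst hbc
    refine key u [(i, b), (j, b), (i, b)] [(j, b), (i, b), (j, b)] t e ?_ rfl ?_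
    · have h3 (x y z : Fin (n - 1) × Bool) : BraidWord.toBraid ([x, y, z] : BraidWord n) =
          BraidWord.toBraid ([x] : BraidWord n) * BraidWord.toBraid ([y] : BraidWord n) *
            BraidWord.toBraid ([z] : BraidWord n) := by
        rw [← BraidWord.toBraid_append, ← BraidWord.toBraid_append]
        rfl
      have hr := braid_relation j i hij.symm
      simp only [h3, toBraid_mk_singleton]
      -- For negative letters the relation needed is the inverse of the braid relation.
      cases b
      · simp only [Bool.false_eq_true, if_false, zpow_neg, zpow_one]
        simpa [mul_assoc] using congrArg (·⁻¹) hr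
      · simpa using hr
    · simp only [List.cons_append, List.nil_append, wordWeight, List.length_cons] at hij ⊢
      nlinarith

/-! ### The bound, assuming that closures are invariants of braids. -/

/-- By invariance every link type is attained on a normal word of length exactly `μ`. Such words are
bounded both by the transfer count and by the number of all words of that length. -/
theorem ncard_le_of_forall_eq {n μ : ℕ}
    (hinv : ∀ w w' : BraidWord n, w.toBraid = w'.toBraid →
      AmbientIsotopic (closedBraid w) (closedBraid w')) (hμ : 1 ≤ μ) :
    (closedBraidTypes n μ).Finite ∧
      (closedBraidTypes n μ).ncard ≤ (normalWords (n - 1) (μ - 1)).card ∧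
      (closedBraidTypes n μ).ncard ≤ (2 * (n - 1)) ^ μ := by
  let f : BraidWord n → IsotopyClass := fun w => Quotient.mk ambientIsotopySetoid (closedBraid w)
  have hsub : ∀ K ∈ closedBraidTypes n μ, ∃ w : BraidWord n, IsNormalWord w ∧ w.length = μ ∧
      f w = K := by
    rintro K ⟨w, hw, rfl⟩
    obtain ⟨w', h1, h2, h3⟩ := exists_isNormalWord w
    exact ⟨w', h3, h2.trans hw, Quotient.sound (hinv _ _ h1)⟩
  have h1 : closedBraidTypes n μ ⊆ f '' (normalWords (n - 1) (μ - 1) : Set (BraidWord n)) := by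
    intro K hK
    obtain ⟨w, hw, hl, rfl⟩ := hsub K hK
    exact ⟨w, hw.mem_normalWords (by omega), rfl⟩
  have h2 : closedBraidTypes n μ ⊆ Set.range fun v : List.Vector (Fin (n - 1) × Bool) μ => f v.1 := by
    intro K hK
    obtain ⟨w, hw, hl, rfl⟩ := hsub K hK
    exact ⟨⟨w, hl⟩, rfl⟩
  have hfin : (f '' (normalWords (n - 1) (μ - 1) : Set (BraidWord n))).Finite :=
    (Finset.finite_toSet _).image f
  refine ⟨hfin.subset h1, ?_, ?_⟩
  · refine (Set.ncard_le_ncard h1 hfin).trans ((Set.ncard_image_le (Finset.finite_toSet _)).trans ?_)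
    rw [Set.ncard_coe_finset]
  · refine (Set.ncard_le_ncard h2 (Set.finite_range _)).trans ?_
    rw [← Set.image_univ]
    refine (Set.ncard_image_le Set.finite_univ).trans ?_
    rw [Set.ncard_univ, Nat.card_eq_fintype_card, card_vector]
    simp [mul_comm]

theorem main_of_invariance
    (hinv : ∀ n (w w' : BraidWord n), w.toBraid = w'.toBraid →
      AmbientIsotopic (closedBraid w) (closedBraid w')) :
    ∃ N M : ℕ, ∀ n μ : ℕ, N ≤ n → M ≤ μ →
      (closedBraidTypes n μ).Finite ∧
      ((closedBraidTypes n μ).ncard : ℝ) <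
        32 * Real.pi ^ 2 / Real.log 2 ^ 4 * ((2 : ℝ) ^ n / (n : ℝ) ^ 3) * (7 : ℝ) ^ (μ - 1) := by
  obtain ⟨N, hN⟩ := eventually_lt_of_le_of_le
  refine ⟨max N 1, 1, fun n μ hn hμ => ?_⟩
  have hn1 : 1 ≤ n := (le_max_right _ _).trans hn
  obtain ⟨hfin, h1, h2⟩ := ncard_le_of_forall_eq (hinv n) hμ
  refine ⟨hfin, ?_⟩
  have hlt := hN n (μ - 1) ((le_max_left _ _).trans hn) (closedBraidTypes n μ).ncard ?_ ?_
  · refine hlt.trans_le ?_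
    have hlog : Real.log 2 ^ 4 ≤ 1 :=
      pow_le_one₀ (Real.log_nonneg (by norm_num)) (by linarith [Real.log_two_lt_d9])
    have hlog0 : 0 < Real.log 2 ^ 4 := pow_pos (Real.log_pos (by norm_num)) 4
    -- The constant 288 is 32 · 9, and the denominator log⁴ 2 is at most 1.
    have hpi : 9 ≤ Real.pi ^ 2 := by nlinarith [Real.pi_gt_three]
    gcongr
    rw [le_div_iff₀ hlog0]
    nlinarith
  · refine (Nat.cast_le.2 h1).trans ?_
    simpa [Nat.sub_add_cancel hn1] using card_normalWords_le (n - 1) (μ - 1)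
  · have h3 : (closedBraidTypes n μ).ncard ≤ (2 * n) ^ (μ - 1 + 1) := by
      rw [Nat.sub_add_cancel hμ]
      exact h2.trans (Nat.pow_le_pow_left (by omega) _)
    exact_mod_cast h3

/-! ### The space of unordered configurations. -/

noncomputable section

open Filter Topology

/-- Ordered configurations of `n` distinct points of the half plane `-1 < Re z`. -/
abbrev OrdConf (n : ℕ) : Type :=
  {f : Fin n → ℂ // Function.Injective f ∧ ∀ j, -1 < (f j).re}

theorem OrdConf.continuous_coord {n : ℕ} {X : Type*} [TopologicalSpace X] {F : X → OrdConf n}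
    (hF : Continuous F) (j : Fin n) : Continuous fun x => (F x).1 j :=
  (continuous_apply j).comp (continuous_subtype_val.comp hF)

/-- Ordered configurations are equivalent when they differ by a permutation of the points. -/
def confSetoid (n : ℕ) : Setoid (OrdConf n) where
  r f g := ∃ σ : Equiv.Perm (Fin n), ∀ j, g.1 j = f.1 (σ j)
  iseqv := ⟨fun f => ⟨1, fun _ => rfl⟩, fun ⟨σ, h⟩ => ⟨σ⁻¹, fun j => by simp [h]⟩,
    fun ⟨σ, h⟩ ⟨τ, k⟩ => ⟨τ.trans σ, fun j => by simp [h, k]⟩⟩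

/-- Unordered configurations of `n` distinct points of the half plane `-1 < Re z`. -/
def Conf (n : ℕ) : Type := Quotient (confSetoid n)

instance Conf.instTopologicalSpace (n : ℕ) : TopologicalSpace (Conf n) :=
  inferInstanceAs (TopologicalSpace (Quotient (confSetoid n)))

/-- The unordered configuration of an ordered one. -/
def Conf.mk {n : ℕ} (f : OrdConf n) : Conf n := Quotient.mk (confSetoid n) f

theorem Conf.continuous_mk {n : ℕ} : Continuous (Conf.mk : OrdConf n → Conf n) :=
  continuous_quot_mk

theorem Conf.mk_eq_iff {n : ℕ} {f g : OrdConf n} :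
    Conf.mk f = Conf.mk g ↔ ∃ σ : Equiv.Perm (Fin n), ∀ j, g.1 j = f.1 (σ j) :=
  Quotient.eq (r := confSetoid n)

/-- The saturation of an open set is the union of its translates by permutations. Openness is what
makes products of these quotient maps quotient maps again. -/
theorem Conf.isOpenQuotientMap_mk (n : ℕ) : IsOpenQuotientMap (Conf.mk : OrdConf n → Conf n) := by
  refine ⟨Quotient.mk_surjective, Conf.continuous_mk, fun U hU => ?_⟩
  have h : Conf.mk ⁻¹' (Conf.mk '' U) = ⋃ σ : Equiv.Perm (Fin n),
      (fun f : OrdConf n => (⟨f.1 ∘ σ, f.2.1.comp σ.injective, fun j => f.2.2 (σ j)⟩ :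
        OrdConf n)) ⁻¹' U := by
    ext f
    simp only [Set.mem_preimage, Set.mem_image, Set.mem_iUnion]
    constructor
    · rintro ⟨g, hg, e⟩
      obtain ⟨σ, h⟩ := Conf.mk_eq_iff.1 e.symm
      refine ⟨σ, ?_⟩
      convert hg using 1
      exact Subtype.ext (funext fun j => (h j).symm)
    · rintro ⟨σ, h⟩
      exact ⟨_, h, (Conf.mk_eq_iff.2 ⟨σ, fun j => rfl⟩).symm⟩
  refine isOpen_coinduced.2 (?_ : IsOpen (Conf.mk ⁻¹' (Conf.mk '' U)))
  rw [h]
  refine isOpen_iUnion fun σ => hU.preimage (Continuous.subtype_mk ?_ _)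
  exact continuous_pi fun j => OrdConf.continuous_coord continuous_id (σ j)

/-- The set of points of a configuration. -/
def Conf.points {n : ℕ} (P : Conf n) : Set ℂ :=
  Quotient.liftOn P (fun f => Set.range f.1) (by
    rintro f g ⟨σ, h⟩
    have : g.1 = f.1 ∘ σ := funext h
    rw [this, σ.surjective.range_comp])

theorem Conf.points_mk {n : ℕ} (f : OrdConf n) : (Conf.mk f).points = Set.range f.1 := rfl

/-! ### Vector fields that push a configuration to a nearby one. -/

/-- A piecewise linear function that is `1` at `0` and vanishes from `ε` on. -/
def bump (ε r : ℝ) : ℝ := max 0 (1 - r / ε)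

/-- A piecewise linear function that is `1` up to `ε` and vanishes from `2ε` on. -/
def cutoff (ε r : ℝ) : ℝ := max 0 (min 1 (2 - r / ε))

/-- A vector field that moves the points of the first configuration to the nearby points of the
second one. -/
def OrdConf.push {n : ℕ} (ε : ℝ) (f g : OrdConf n) (z : ℂ) : ℂ :=
  ∑ i, ∑ j, ((bump ε ‖z - f.1 i‖ * cutoff ε ‖g.1 j - f.1 i‖ : ℝ) : ℂ) * (g.1 j - f.1 i)

/-- The vector field `OrdConf.push` of unordered configurations. -/
def Conf.push {n : ℕ} (ε : ℝ) (P Q : Conf n) (z : ℂ) : ℂ :=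
  Quotient.liftOn₂ P Q (fun f g => OrdConf.push ε f g z) (by
    rintro f g f' g' ⟨σ, h⟩ ⟨τ, k⟩
    simp only [OrdConf.push, h, k]
    rw [← Equiv.sum_comp σ]
    exact Finset.sum_congr rfl fun i _ => (Equiv.sum_comp τ _).symm)

theorem OrdConf.continuous_push {n : ℕ} (ε : ℝ) :
    Continuous fun p : (OrdConf n × OrdConf n) × ℂ => OrdConf.push ε p.1.1 p.1.2 p.2 := by
  have h : Continuous fun q : ℂ × ℂ × ℂ =>
      ((bump ε ‖q.1 - q.2.1‖ * cutoff ε ‖q.2.2 - q.2.1‖ : ℝ) : ℂ) * (q.2.2 - q.2.1) := by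
    unfold bump cutoff
    fun_prop
  simp only [OrdConf.push]
  refine continuous_finsetSum _ fun i _ => continuous_finsetSum _ fun j _ => ?_
  have hf : Continuous fun p : (OrdConf n × OrdConf n) × ℂ => p.1.1.1 i :=
    OrdConf.continuous_coord (continuous_fst.comp continuous_fst) i
  have hg : Continuous fun p : (OrdConf n × OrdConf n) × ℂ => p.1.2.1 j :=
    OrdConf.continuous_coord (continuous_snd.comp continuous_fst) j
  have hfg : Continuous fun p : (OrdConf n × OrdConf n) × ℂ => (p.2, p.1.1.1 i, p.1.2.1 j) :=
    continuous_snd.prodMk (hf.prodMk hg)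
  generalize hF : (fun q : ℂ × ℂ × ℂ =>
    ((bump ε ‖q.1 - q.2.1‖ * cutoff ε ‖q.2.2 - q.2.1‖ : ℝ) : ℂ) * (q.2.2 - q.2.1)) = F at h
  refine (h.comp hfg).congr fun p => ?_
  rw [← hF]
  rfl

/-- The double sum over all pairs is symmetric in both lists, so it needs no choice of a pairing;
continuity therefore descends from ordered configurations. -/
theorem Conf.continuous_push {n : ℕ} (ε : ℝ) :
    Continuous fun p : (Conf n × Conf n) × ℂ => Conf.push ε p.1.1 p.1.2 p.2 := by
  have hq := ((Conf.isOpenQuotientMap_mk n).prodMap (Conf.isOpenQuotientMap_mk n)).prodMap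
    (IsOpenQuotientMap.id (X := ℂ))
  exact hq.continuous_comp_iff.1 (OrdConf.continuous_push ε)

/-- The points of the configuration have distance more than `δ` from one another and from the
boundary of the half plane. -/
def Conf.Separated {n : ℕ} (δ : ℝ) (P : Conf n) : Prop :=
  ∃ f : OrdConf n, Conf.mk f = P ∧ (∀ i j, i ≠ j → δ < ‖f.1 i - f.1 j‖) ∧ ∀ j, δ - 1 < (f.1 j).re

/-- The points of the two configurations can be paired so that partners have distance less
than `η`. -/
def Conf.Close {n : ℕ} (η : ℝ) (P Q : Conf n) : Prop :=
  ∃ f g : OrdConf n, Conf.mk f = P ∧ Conf.mk g = Q ∧ ∀ j, ‖g.1 j - f.1 j‖ < η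

theorem Conf.isOpen_separated {n : ℕ} (δ : ℝ) : IsOpen {P : Conf n | P.Separated δ} := by
  have h : {P : Conf n | P.Separated δ} = Conf.mk ''
      {f : OrdConf n | (∀ i j, i ≠ j → δ < ‖f.1 i - f.1 j‖) ∧ ∀ j, δ - 1 < (f.1 j).re} := by
    ext P
    exact ⟨fun ⟨f, hf, h⟩ => ⟨f, h, hf⟩, fun ⟨f, h, hf⟩ => ⟨f, hf, h⟩⟩
  rw [h]
  refine (Conf.isOpenQuotientMap_mk n).isOpenMap _ ?_
  simp only [Set.ofPred_and, Set.ofPred_forall]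
  refine IsOpen.inter ?_ ?_
  · exact isOpen_iInter_of_finite fun i => isOpen_iInter_of_finite fun j =>
      isOpen_iInter_of_finite fun _ => isOpen_lt continuous_const
        ((OrdConf.continuous_coord continuous_id i).sub
          (OrdConf.continuous_coord continuous_id j)).norm
  · exact isOpen_iInter_of_finite fun j => isOpen_lt continuous_const
      (Complex.continuous_re.comp (OrdConf.continuous_coord continuous_id j))

theorem Conf.isOpen_close {n : ℕ} (η : ℝ) : IsOpen {p : Conf n × Conf n | p.1.Close η p.2} := by
  have h : {p : Conf n × Conf n | p.1.Close η p.2} = Prod.map Conf.mk Conf.mk ''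
      {p : OrdConf n × OrdConf n | ∀ j, ‖p.2.1 j - p.1.1 j‖ < η} := by
    ext ⟨P, Q⟩
    constructor
    · rintro ⟨f, g, rfl, rfl, h⟩
      exact ⟨(f, g), h, rfl⟩
    · rintro ⟨⟨f, g⟩, h, e⟩
      obtain ⟨rfl, rfl⟩ := Prod.mk.inj e
      exact ⟨f, g, rfl, rfl, h⟩
  rw [h]
  refine ((Conf.isOpenQuotientMap_mk n).prodMap (Conf.isOpenQuotientMap_mk n)).isOpenMap _ ?_
  simp only [Set.ofPred_forall]
  exact isOpen_iInter_of_finite fun j => isOpen_lt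
    ((OrdConf.continuous_coord continuous_snd j).sub
      (OrdConf.continuous_coord continuous_fst j)).norm continuous_const

theorem Conf.close_refl {n : ℕ} {η : ℝ} (hη : 0 < η) (P : Conf n) : P.Close η P := by
  obtain ⟨f, rfl⟩ := (Conf.isOpenQuotientMap_mk n).surjective P
  exact ⟨f, f, rfl, rfl, fun j => by simpa⟩

theorem Conf.Separated.mono {n : ℕ} {δ δ' : ℝ} (h : δ' ≤ δ) {P : Conf n} (hP : P.Separated δ) :
    P.Separated δ' := by
  obtain ⟨f, hf, h1, h2⟩ := hP
  exact ⟨f, hf, fun i j hij => h.trans_lt (h1 i j hij), fun j => by linarith [h2 j]⟩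

theorem Conf.exists_separated {n : ℕ} (P : Conf n) : ∃ δ > 0, P.Separated δ := by
  obtain ⟨f, rfl⟩ := (Conf.isOpenQuotientMap_mk n).surjective P
  have h1 : ∀ᶠ δ in 𝓝[>] (0 : ℝ), ∀ i j, i ≠ j → δ < ‖f.1 i - f.1 j‖ := by
    refine eventually_all.2 fun i => eventually_all.2 fun j => eventually_all.2 fun hij => ?_
    exact nhdsWithin_le_nhds (gt_mem_nhds (norm_pos_iff.2 (sub_ne_zero.2 (f.2.1.ne hij))))
  have h2 : ∀ᶠ δ in 𝓝[>] (0 : ℝ), ∀ j, δ - 1 < (f.1 j).re := by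
    refine eventually_all.2 fun j => ?_
    filter_upwards [nhdsWithin_le_nhds (gt_mem_nhds (show 0 < (f.1 j).re + 1 by
      linarith [f.2.2 j]))] with δ hδ
    linarith
  obtain ⟨δ, h1, h2, h3⟩ := (h1.and (h2.and self_mem_nhdsWithin)).exists
  exact ⟨δ, h3, f, rfl, h1, h2⟩

/-- The sets of separated configurations are open, increase as the distance shrinks, and cover the
whole space; compactness gives one distance. -/
theorem exists_separated_of_isCompact {n : ℕ} {K : Set (Conf n)} (hK : IsCompact K) :
    ∃ δ > 0, ∀ P ∈ K, P.Separated δ := by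
  obtain ⟨δ, hδ⟩ := hK.elim_directed_cover (ι := {δ : ℝ // 0 < δ})
    (fun δ => {P : Conf n | P.Separated δ.1}) (fun δ => Conf.isOpen_separated δ.1)
    (fun P _ => by
      obtain ⟨δ, h, hP⟩ := P.exists_separated
      exact Set.mem_iUnion.2 ⟨⟨δ, h⟩, hP⟩)
    (fun δ δ' => ⟨⟨min δ δ', lt_min δ.2 δ'.2⟩, fun P hP => hP.mono (min_le_left _ _),
      fun P hP => hP.mono (min_le_right _ _)⟩)
  exact ⟨δ, δ.2, hδ⟩

theorem bump_nonneg (ε r : ℝ) : 0 ≤ bump ε r := le_max_left _ _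

theorem bump_le_one {ε r : ℝ} (hε : 0 < ε) (hr : 0 ≤ r) : bump ε r ≤ 1 :=
  max_le zero_le_one (by linarith [div_nonneg hr hε.le])

theorem bump_eq_zero {ε r : ℝ} (hε : 0 < ε) (hr : ε ≤ r) : bump ε r = 0 :=
  max_eq_left (by linarith [(one_le_div hε).2 hr])

theorem abs_bump_sub_le {ε : ℝ} (hε : 0 < ε) (r s : ℝ) :
    |bump ε r - bump ε s| ≤ |r - s| / ε := by
  refine (abs_max_sub_max_le_max _ _ _ _).trans ?_
  rw [sub_self, abs_zero, max_eq_right (abs_nonneg _), show 1 - r / ε - (1 - s / ε) =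
    -((r - s) / ε) by ring, abs_neg, abs_div, abs_of_pos hε]

/-- The data of `n` well separated points and of `n` points close to them, in the same order. -/
structure PushData {n : ℕ} (ε : ℝ) (f g : OrdConf n) : Prop where
  pos : 0 < ε
  sep : ∀ i j, i ≠ j → 4 * ε < ‖f.1 i - f.1 j‖
  lt_re : ∀ j, 4 * ε - 1 < (f.1 j).re
  close : ∀ j, ‖g.1 j - f.1 j‖ < ε / (n + 1)

theorem exists_pushData {n : ℕ} {ε : ℝ} (hε : 0 < ε) {P Q : Conf n} (hP : P.Separated (4 * ε))
    (hPQ : P.Close (ε / (n + 1)) Q) :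
    ∃ f g : OrdConf n, Conf.mk f = P ∧ Conf.mk g = Q ∧ PushData ε f g := by
  obtain ⟨f₀, hf₀, h1, h2⟩ := hP
  obtain ⟨f, g, rfl, rfl, h3⟩ := hPQ
  obtain ⟨σ, hσ⟩ := Conf.mk_eq_iff.1 hf₀
  refine ⟨f, g, rfl, rfl, hε, fun i j hij => ?_, fun j => ?_, h3⟩
  · rw [hσ, hσ]
    exact h1 _ _ (σ.injective.ne hij)
  · rw [hσ]
    exact h2 _

namespace PushData

variable {n : ℕ} {ε : ℝ} {f g : OrdConf n}

theorem close' (h : PushData ε f g) (j : Fin n) : ‖g.1 j - f.1 j‖ < ε :=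
  (h.close j).trans_le (div_le_self h.pos.le (by linarith [n.cast_nonneg (α := ℝ)]))

/-- The cutoff recovers the pairing: partners have distance below ε, and any other pair has distance
above 2ε because the points of `f` are more than 4ε apart. -/
theorem push_eq (h : PushData ε f g) (z : ℂ) :
    OrdConf.push ε f g z = ∑ j, (bump ε ‖z - f.1 j‖ : ℂ) * (g.1 j - f.1 j) := by
  have hε := h.pos
  refine Finset.sum_congr rfl fun i _ => ?_
  rw [Finset.sum_eq_single i]
  · have : cutoff ε ‖g.1 i - f.1 i‖ = 1 := by
      have := (div_lt_one hε).2 (h.close' i)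
      rw [cutoff, min_eq_left (by linarith), max_eq_right zero_le_one]
    rw [this, mul_one]
  · intro j _ hji
    have h1 : 2 * ε ≤ ‖g.1 j - f.1 i‖ := by
      have := norm_sub_norm_le (f.1 j - f.1 i) (f.1 j - g.1 j)
      rw [sub_sub_sub_cancel_left, norm_sub_rev (f.1 j) (g.1 j)] at this
      linarith [h.sep j i hji, h.close' j]
    have : cutoff ε ‖g.1 j - f.1 i‖ = 0 := by
      have := (le_div_iff₀ hε).2 h1
      rw [cutoff, max_eq_left ((min_le_right _ _).trans (by linarith))]
    simp [this]
  · simp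

theorem push_apply (h : PushData ε f g) (j : Fin n) :
    OrdConf.push ε f g (f.1 j) = g.1 j - f.1 j := by
  rw [h.push_eq, Finset.sum_eq_single j]
  · simp [bump]
  · intro i _ hij
    rw [bump_eq_zero h.pos (by linarith [h.sep j i hij.symm, h.pos])]
    simp
  · simp

theorem card_mul_lt (h : PushData ε f g) : n * (ε / (n + 1)) < ε := by
  have := h.pos
  rw [← mul_div_assoc, div_lt_iff₀ (by positivity)]
  nlinarith

theorem norm_push_le (h : PushData ε f g) (z : ℂ) : ‖OrdConf.push ε f g z‖ ≤ ε := by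
  rw [h.push_eq]
  calc _ ≤ ∑ _j : Fin n, ε / (n + 1) := by
        refine norm_sum_le_of_le _ fun j _ => ?_
        rw [norm_mul, Complex.norm_real, Real.norm_of_nonneg (bump_nonneg _ _)]
        exact (mul_le_of_le_one_left (norm_nonneg _)
          (bump_le_one h.pos (norm_nonneg _))).trans (h.close j).le
    _ = n * (ε / (n + 1)) := by simp
    _ ≤ ε := h.card_mul_lt.le

theorem push_eq_zero (h : PushData ε f g) {z : ℂ} (hz : z.re < -1 + 2 * ε) :
    OrdConf.push ε f g z = 0 := by
  rw [h.push_eq]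
  refine Finset.sum_eq_zero fun j _ => ?_
  have h1 : ε ≤ ‖z - f.1 j‖ := by
    refine le_trans ?_ (Complex.abs_re_le_norm _)
    refine le_trans ?_ (neg_le_abs _)
    rw [Complex.sub_re]
    linarith [h.lt_re j, h.pos]
  rw [bump_eq_zero h.pos h1]
  simp

/-- Each of the n terms is a (1/ε)-Lipschitz bump times a vector shorter than ε/(n + 1); this is why
closeness is measured by ε/(n + 1), giving a total constant below 1. -/
theorem norm_push_sub_le (h : PushData ε f g) (z w : ℂ) :
    ‖OrdConf.push ε f g z - OrdConf.push ε f g w‖ ≤ n / (n + 1) * ‖z - w‖ := by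
  have hε := h.pos
  rw [h.push_eq, h.push_eq, ← Finset.sum_sub_distrib]
  calc _ ≤ ∑ _j : Fin n, ‖z - w‖ / ε * (ε / (n + 1)) := by
        refine norm_sum_le_of_le _ fun j _ => ?_
        rw [← sub_mul, norm_mul, ← Complex.ofReal_sub, Complex.norm_real, Real.norm_eq_abs]
        gcongr
        · refine (abs_bump_sub_le hε _ _).trans ?_
          gcongr
          refine (abs_norm_sub_norm_le _ _).trans ?_
          rw [sub_sub_sub_cancel_right]
        · exact (h.close j).le
    _ = _ := by
        simp
        field_simp

theorem points_eq (h : PushData ε f g) :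
    (Conf.mk g).points = (fun z => z + OrdConf.push ε f g z) '' (Conf.mk f).points := by
  rw [Conf.points_mk, Conf.points_mk, ← Set.range_comp]
  congr 1
  ext j
  simp [h.push_apply]

end PushData

/-! ### Moving the pages of an open book. -/

/-- A preimage of `y` is a fixed point of the contraction `z ↦ y - L z`. -/
theorem bijective_id_add {E : Type*} [NormedAddCommGroup E] [CompleteSpace E] {L : E → E} {K : ℝ}
    (hK : K < 1) (hL : ∀ z w, ‖L z - L w‖ ≤ K * ‖z - w‖) :
    Function.Bijective fun z => z + L z := by
  constructor
  · intro z w h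
    have h1 : z - w = -(L z - L w) := by
      have : z + L z = w + L w := h
      rw [neg_sub, sub_eq_sub_iff_add_eq_add, this]
      abel
    have h2 := hL z w
    rw [← norm_neg, ← h1] at h2
    have h3 : ‖z - w‖ ≤ 0 := by nlinarith [norm_nonneg (z - w)]
    exact sub_eq_zero.1 (norm_le_zero_iff.1 h3)
  · intro y
    have hc : ContractingWith K.toNNReal fun z => y - L z := by
      refine ⟨by simpa using hK, LipschitzWith.of_dist_le_mul fun z w => ?_⟩
      rw [dist_eq_norm, dist_eq_norm, sub_sub_sub_cancel_left, norm_sub_rev]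
      refine (hL z w).trans ?_
      gcongr
      exact Real.le_coe_toNNReal K
    refine ⟨hc.fixedPoint, ?_⟩
    have : y - L hc.fixedPoint = hc.fixedPoint := hc.fixedPoint_isFixedPt
    change _ + _ = _
    nth_rw 1 [← this]
    abel

/-- A horizontal plane with a vertical axis, as cylinder coordinates of `ℝ³`. -/
def cylinderHomeo : Space3 ≃ₜ ℂ × ℝ where
  toFun x := (⟨x 0, x 1⟩, x 2)
  invFun p := !₂[p.1.re, p.1.im, p.2]
  left_inv x := by
    ext i
    fin_cases i <;> rfl
  right_inv p := rfl
  continuous_toFun := by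
    have h : Continuous fun x : Space3 => ((x 0 : ℂ) + (x 1 : ℂ) * Complex.I, x 2) := by fun_prop
    convert h using 3 with x
    apply Complex.ext <;> simp
  continuous_invFun := by
    refine (PiLp.continuous_toLp 2 _).comp (continuous_pi fun i => ?_)
    fin_cases i
    · exact Complex.continuous_re.comp continuous_fst
    · exact Complex.continuous_im.comp continuous_fst
    · exact continuous_snd

theorem cylinderHomeo_apply (x : Space3) : cylinderHomeo x = (⟨x 0, x 1⟩, x 2) := rfl

theorem cylinderHomeo_pagePoint (z : ℂ) (t : ℝ) :
    cylinderHomeo (pagePoint z t) =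
      (((1 + z.re : ℝ) : ℂ) * Complex.exp ((2 * Real.pi * t : ℝ) * Complex.I), z.im) := by
  refine Prod.ext ?_ rfl
  apply Complex.ext
  · simp [cylinderHomeo_apply, pagePoint, Complex.exp_ofReal_mul_I_re, Complex.exp_ofReal_mul_I_im,
      -Complex.ofReal_mul]
  · simp [cylinderHomeo_apply, pagePoint, Complex.exp_ofReal_mul_I_re, Complex.exp_ofReal_mul_I_im,
      -Complex.ofReal_mul]

/-- A vector field on the pages of the open book of half planes around the vertical axis: the page
through `c` is moved by `W c`, which is small, contracting, and zero near the axis. -/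
structure IsPageField (ε K : ℝ) (W : ℂ → ℂ → ℂ) : Prop where
  pos : 0 < ε
  lt_one : K < 1
  apply_mul : ∀ (c : ℂ) (s : ℝ), 0 < s → W (c * s) = W c
  continuousAt : ∀ c z, c ≠ 0 → ContinuousAt (fun p : ℂ × ℂ => W p.1 p.2) (c, z)
  norm_sub_le : ∀ c z w, ‖W c z - W c w‖ ≤ K * ‖z - w‖
  eq_zero : ∀ c z, z.re < -1 + 2 * ε → W c z = 0
  norm_le : ∀ c z, ‖W c z‖ ≤ ε

/-- The coordinate in the page of a point. -/
def pageCoord (p : ℂ × ℝ) : ℂ := ⟨‖p.1‖ - 1, p.2⟩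

/-- The map that moves the point with page coordinate `z` in the page through `c` to the point with
page coordinate `z + r W c z`. -/
def pageMap (W : ℂ → ℂ → ℂ) (r : ℝ) (p : ℂ × ℝ) : ℂ × ℝ :=
  (p.1 * ((1 + r * (W p.1 (pageCoord p)).re / ‖p.1‖ : ℝ) : ℂ),
    p.2 + r * (W p.1 (pageCoord p)).im)

theorem continuous_pageCoord : Continuous pageCoord := by
  have h : Continuous fun p : ℂ × ℝ => ((‖p.1‖ - 1 : ℝ) : ℂ) + (p.2 : ℂ) * Complex.I := by fun_prop
  convert h using 2 with p
  apply Complex.ext <;> simp [pageCoord]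

namespace IsPageField

variable {ε K : ℝ} {W : ℂ → ℂ → ℂ}

theorem pageMap_of_norm_lt (hW : IsPageField ε K W) (r : ℝ) {p : ℂ × ℝ} (hp : ‖p.1‖ < 2 * ε) :
    pageMap W r p = p := by
  have : W p.1 (pageCoord p) = 0 := hW.eq_zero _ _ (by simp only [pageCoord]; linarith)
  simp [pageMap, this]

/-- The field is at most ε in size and vanishes within distance 2ε of the axis, so no point is
pushed to or across the axis. The positive factor keeps each point on its page. -/
theorem factor_pos (hW : IsPageField ε K W) {r : ℝ} (hr : r ∈ Set.Icc (0 : ℝ) 1) {p : ℂ × ℝ}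
    (hp : p.1 ≠ 0) : 0 < 1 + r * (W p.1 (pageCoord p)).re / ‖p.1‖ := by
  have h0 : 0 < ‖p.1‖ := norm_pos_iff.2 hp
  rcases lt_or_ge ‖p.1‖ (2 * ε) with h | h
  · have : W p.1 (pageCoord p) = 0 := hW.eq_zero _ _ (by simp only [pageCoord]; linarith)
    simp [this]
  · have h1 := (abs_le.1 ((Complex.abs_re_le_norm _).trans (hW.norm_le p.1 (pageCoord p)))).1
    have h2 : -‖p.1‖ < r * (W p.1 (pageCoord p)).re := by nlinarith [hr.1, hr.2, hW.pos]
    have h3 : -1 < r * (W p.1 (pageCoord p)).re / ‖p.1‖ := by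
      rw [lt_div_iff₀ h0]
      linarith
    linarith

theorem pageMap_fst_ne_zero (hW : IsPageField ε K W) {r : ℝ} (hr : r ∈ Set.Icc (0 : ℝ) 1)
    {p : ℂ × ℝ} (hp : p.1 ≠ 0) : (pageMap W r p).1 ≠ 0 :=
  mul_ne_zero hp (Complex.ofReal_ne_zero.2 (hW.factor_pos hr hp).ne')

theorem pageCoord_pageMap (hW : IsPageField ε K W) {r : ℝ} (hr : r ∈ Set.Icc (0 : ℝ) 1)
    {p : ℂ × ℝ} (hp : p.1 ≠ 0) :
    pageCoord (pageMap W r p) = pageCoord p + r * W p.1 (pageCoord p) := by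
  have h0 : ‖p.1‖ ≠ 0 := norm_ne_zero_iff.2 hp
  apply Complex.ext
  · simp only [pageCoord, pageMap, norm_mul, Complex.norm_real, Complex.add_re, Complex.re_ofReal_mul]
    have h1 := hW.factor_pos hr hp
    simp only [pageCoord] at h1
    rw [Real.norm_of_nonneg h1.le]
    field_simp
    ring
  · simp [pageCoord, pageMap]

theorem field_pageMap (hW : IsPageField ε K W) {r : ℝ} (hr : r ∈ Set.Icc (0 : ℝ) 1)
    {p : ℂ × ℝ} (hp : p.1 ≠ 0) : W (pageMap W r p).1 = W p.1 :=
  hW.apply_mul _ _ (hW.factor_pos hr hp)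

theorem bijective_page (hW : IsPageField ε K W) {r : ℝ} (hr : r ∈ Set.Icc (0 : ℝ) 1) (c : ℂ) :
    Function.Bijective fun z => z + r * W c z := by
  refine bijective_id_add (K := K) hW.lt_one fun z w => ?_
  rw [← mul_sub, norm_mul, Complex.norm_real, Real.norm_of_nonneg hr.1]
  exact (mul_le_of_le_one_left (norm_nonneg _) hr.2).trans (hW.norm_sub_le c z w)

theorem injective_pageMap (hW : IsPageField ε K W) {r : ℝ} (hr : r ∈ Set.Icc (0 : ℝ) 1) :
    Function.Injective (pageMap W r) := by
  intro p q h
  by_cases hp : p.1 = 0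
  · by_cases hq : q.1 = 0
    · have hε := hW.pos
      rwa [hW.pageMap_of_norm_lt r (by rw [hp, norm_zero]; positivity),
        hW.pageMap_of_norm_lt r (by rw [hq, norm_zero]; positivity)] at h
    · have h1 := hW.pageMap_fst_ne_zero hr hq
      rw [← h] at h1
      simp [pageMap, hp] at h1
  · by_cases hq : q.1 = 0
    · have h1 := hW.pageMap_fst_ne_zero hr hp
      rw [h] at h1
      simp [pageMap, hq] at h1
    · have h1 : W p.1 = W q.1 := by rw [← hW.field_pageMap hr hp, h, hW.field_pageMap hr hq]
      have h2 : pageCoord p = pageCoord q := by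
        apply (hW.bijective_page hr p.1).1
        change pageCoord p + r * W p.1 _ = pageCoord q + r * W p.1 _
        rw [← hW.pageCoord_pageMap hr hp, h, hW.pageCoord_pageMap hr hq, h1]
      have h3 : ‖p.1‖ = ‖q.1‖ := by simpa [pageCoord] using congrArg Complex.re h2
      have h4 : p.2 = q.2 := congrArg Complex.im h2
      have h5 := congrArg Prod.fst h
      simp only [pageMap] at h5
      rw [← h1, ← h2, ← h3] at h5
      exact Prod.ext (mul_right_cancel₀
        (Complex.ofReal_ne_zero.2 (hW.factor_pos hr hp).ne') h5) h4

theorem surjective_pageMap (hW : IsPageField ε K W) {r : ℝ} (hr : r ∈ Set.Icc (0 : ℝ) 1) :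
    Function.Surjective (pageMap W r) := by
  intro q
  have hε := hW.pos
  by_cases hq : q.1 = 0
  · exact ⟨q, hW.pageMap_of_norm_lt r (by rw [hq, norm_zero]; positivity)⟩
  · have hq0 : 0 < ‖q.1‖ := norm_pos_iff.2 hq
    obtain ⟨z, hz⟩ := (hW.bijective_page hr q.1).2 (pageCoord q)
    have hz' : z + r * W q.1 z = pageCoord q := hz
    have hre : z.re + r * (W q.1 z).re = ‖q.1‖ - 1 := by
      simpa [pageCoord] using congrArg Complex.re hz'
    have him : z.im + r * (W q.1 z).im = q.2 := by
      simpa [pageCoord] using congrArg Complex.im hz'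
    -- Beyond the axis the field vanishes, so `z` would be the page coordinate of `q`, whose radius
    -- is positive.
    have hpos : 0 < 1 + z.re := by
      by_contra hneg
      have : W q.1 z = 0 := hW.eq_zero _ _ (by linarith)
      rw [this] at hre
      simp only [Complex.zero_re] at hre
      linarith
    let s : ℝ := (1 + z.re) / ‖q.1‖
    have hs : 0 < s := by positivity
    have hns : ‖q.1 * (s : ℂ)‖ = 1 + z.re := by
      rw [norm_mul, Complex.norm_real, Real.norm_of_nonneg hs.le]
      simp only [s]
      field_simp
    have hc : pageCoord (q.1 * (s : ℂ), z.im) = z := by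
      apply Complex.ext
      · simp only [pageCoord, hns]
        ring
      · rfl
    refine ⟨(q.1 * (s : ℂ), z.im), Prod.ext ?_ ?_⟩
    · simp only [pageMap, hc, hW.apply_mul _ _ hs, hns]
      rw [mul_assoc, ← Complex.ofReal_mul]
      have : s * (1 + r * (W q.1 z).re / (1 + z.re)) = 1 := by
        simp only [s]
        field_simp
        linarith
      rw [this, Complex.ofReal_one, mul_one]
    · simp only [pageMap, hc, hW.apply_mul _ _ hs, him]

theorem continuous_pageMap (hW : IsPageField ε K W) :
    Continuous fun x : ℝ × (ℂ × ℝ) => pageMap W x.1 x.2 := by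
  rw [continuous_iff_continuousAt]
  rintro ⟨r, p⟩
  by_cases hp : p.1 = 0
  · have h : ∀ᶠ x : ℝ × (ℂ × ℝ) in 𝓝 (r, p), ‖x.2.1‖ < 2 * ε := by
      have hc : Continuous fun x : ℝ × (ℂ × ℝ) => ‖x.2.1‖ := by fun_prop
      refine hc.continuousAt.eventually_lt continuousAt_const ?_
      have := hW.pos
      simp only [hp, norm_zero]
      positivity
    exact continuousAt_snd.congr (h.mono fun x hx => (hW.pageMap_of_norm_lt x.1 hx).symm)
  · have h1 : ContinuousAt (fun x : ℝ × (ℂ × ℝ) => W x.2.1 (pageCoord x.2)) (r, p) := by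
      have hc : Continuous fun x : ℝ × (ℂ × ℝ) => (x.2.1, pageCoord x.2) :=
        (continuous_fst.comp continuous_snd).prodMk (continuous_pageCoord.comp continuous_snd)
      exact ContinuousAt.comp (x := (r, p)) (g := fun p : ℂ × ℂ => W p.1 p.2) (f := fun x : ℝ × (ℂ × ℝ) => (x.2.1, pageCoord x.2))
        (hW.continuousAt p.1 (pageCoord p) hp) hc.continuousAt
    have h0 : ‖p.1‖ ≠ 0 := norm_ne_zero_iff.2 hp
    have hre := Complex.continuous_re.continuousAt.comp h1
    have him := Complex.continuous_im.continuousAt.comp h1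
    have hc1 : ContinuousAt (fun x : ℝ × (ℂ × ℝ) => x.2.1) (r, p) := by fun_prop
    have hc2 : ContinuousAt (fun x : ℝ × (ℂ × ℝ) => x.2.2) (r, p) := by fun_prop
    refine ContinuousAt.prodMk (hc1.mul (Complex.continuous_ofReal.continuousAt.comp ?_)) ?_
    · exact continuousAt_const.add ((continuousAt_fst.mul hre).div hc1.norm h0)
    · exact hc2.add (continuousAt_fst.mul him)

theorem norm_pageMap_sub_le (hW : IsPageField ε K W) {r : ℝ} (hr : r ∈ Set.Icc (0 : ℝ) 1)
    (p : ℂ × ℝ) : ‖pageMap W r p - p‖ ≤ ε := by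
  have h := hW.norm_le p.1 (pageCoord p)
  have hε := hW.pos
  have h1 := (Complex.abs_re_le_norm _).trans h
  have h2 := (Complex.abs_im_le_norm _).trans h
  have key {x : ℝ} (hx : |x| ≤ ε) : |r * x| ≤ ε := by
    rw [abs_mul, abs_of_nonneg hr.1]
    exact (mul_le_of_le_one_left (abs_nonneg _) hr.2).trans hx
  refine max_le ?_ ?_
  · by_cases hp : p.1 = 0
    · simp [pageMap, hp, hε.le]
    · have h0 : 0 < ‖p.1‖ := norm_pos_iff.2 hp
      have : (pageMap W r p - p).1 =
          p.1 * ((r * (W p.1 (pageCoord p)).re / ‖p.1‖ : ℝ) : ℂ) := by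
        simp only [pageMap, Prod.fst_sub]
        push_cast
        ring
      rw [this, norm_mul, Complex.norm_real, Real.norm_eq_abs, abs_div, abs_norm,
        mul_div_cancel₀ _ h0.ne']
      exact key h1
  · have : (pageMap W r p - p).2 = r * (W p.1 (pageCoord p)).im := by simp [pageMap]
    rw [this]
    exact key h2

end IsPageField

/-- A map at bounded distance from the identity is proper, hence closed; continuity of the inverse
comes for free. -/
theorem isHomeomorph_of_norm_sub_le {E : Type*} [NormedAddCommGroup E] [ProperSpace E]
    {f : E → E} {C : ℝ} (hf : Continuous f) (hb : Function.Bijective f)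
    (hC : ∀ x, ‖f x - x‖ ≤ C) : IsHomeomorph f := by
  have hp : IsProperMap f := by
    refine isProperMap_iff_tendsto_cocompact.2 ⟨hf, ?_⟩
    rw [← Metric.cobounded_eq_cocompact, ← tendsto_norm_atTop_iff_cobounded,
      Metric.cobounded_eq_cocompact]
    refine tendsto_atTop_mono (fun x => ?_)
      (tendsto_atTop_add_const_right _ (-C) (tendsto_norm_cocompact_atTop (E := E)))
    have := norm_sub_norm_le x (f x)
    rw [norm_sub_rev] at this
    linarith [hC x]
  exact (isHomeomorph_iff_continuous_isClosedMap_bijective).2 ⟨hf, hp.isClosedMap, hb⟩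

/-- Moving the pages along a page field is an ambient isotopy. -/
theorem IsPageField.ambientIsotopic {ε K : ℝ} {W : ℂ → ℂ → ℂ} (hW : IsPageField ε K W)
    {A B : Set Space3} (h : pageMap W 1 '' (cylinderHomeo '' A) = cylinderHomeo '' B) :
    AmbientIsotopic A B := by
  have hH (r : unitInterval) : IsHomeomorph (pageMap W r) :=
    isHomeomorph_of_norm_sub_le
      (hW.continuous_pageMap.comp (continuous_const.prodMk continuous_id))
      ⟨hW.injective_pageMap r.2, hW.surjective_pageMap r.2⟩ (hW.norm_pageMap_sub_le r.2)
  refine ⟨fun r => (cylinderHomeo.trans ((hH r).homeomorph)).trans cylinderHomeo.symm, ?_, ?_, ?_⟩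
  · change Continuous fun p : unitInterval × Space3 =>
      cylinderHomeo.symm (pageMap W p.1 (cylinderHomeo p.2))
    exact cylinderHomeo.symm.continuous.comp (hW.continuous_pageMap.comp
      ((continuous_subtype_val.comp continuous_fst).prodMk
        (cylinderHomeo.continuous.comp continuous_snd)))
  · intro x
    change cylinderHomeo.symm (pageMap W 0 (cylinderHomeo x)) = x
    simp [pageMap]
  · change (fun x => cylinderHomeo.symm (pageMap W 1 (cylinderHomeo x))) '' A = B
    rw [Set.image_image] at h
    rw [← Set.image_image cylinderHomeo.symm, h, Set.image_image]
    simp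

/-! ### Closures of loops of configurations. -/

/-- The link in `ℝ³` swept out by a loop of configurations that are placed on the pages of the open
book of half planes around the vertical axis. -/
def loopClosure {n : ℕ} {x : Conf n} (γ : Path x x) : Set Space3 :=
  {p | ∃ t ∈ Set.Icc (0 : ℝ) 1, ∃ z ∈ (γ.extend t).points, p = pagePoint z t}

/-- The configuration of a loop in the page through `c`. -/
def loopPage {X : Type*} [TopologicalSpace X] {x : X} (γ : Path x x) (c : ℂ) : X :=
  γ.extend (Int.fract (c.arg / (2 * Real.pi)))

section LoopPage

variable {X : Type*} [TopologicalSpace X] {x : X} (γ : Path x x)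

theorem exists_loopPage_eq (c : ℂ) : ∃ t : unitInterval, ∀ δ : Path x x, loopPage δ c = δ t :=
  ⟨⟨_, Int.fract_nonneg _, (Int.fract_lt_one _).le⟩, fun δ => δ.extend_apply _⟩

theorem continuous_extend_fract : Continuous fun s : ℝ => γ.extend (Int.fract s) :=
  ContinuousOn.comp_fract'' γ.continuous_extend.continuousOn (by simp)

theorem periodic_extend_fract :
    Function.Periodic (fun s : ℝ => γ.extend (Int.fract (s / (2 * Real.pi)))) (2 * Real.pi) := by
  intro s
  simp only
  rw [add_div, div_self Real.two_pi_pos.ne', Int.fract_add_one]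

/-- A loop as a map on the circle of angles. -/
def angleLoop : Real.Angle → X := (periodic_extend_fract γ).lift

theorem angleLoop_coe (s : ℝ) :
    angleLoop γ (s : Real.Angle) = γ.extend (Int.fract (s / (2 * Real.pi))) := rfl

theorem continuous_angleLoop : Continuous (angleLoop γ) := by
  refine continuous_coinduced_dom.2 ?_
  exact (continuous_extend_fract γ).comp (continuous_id.div_const _)

theorem loopPage_eq_angleLoop (c : ℂ) : loopPage γ c = angleLoop γ (c.arg : Real.Angle) := rfl

/-- The argument jumps on the negative real axis, but as an element of `Real.Angle` it is continuous
away from 0; hence the detour through `angleLoop`. -/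
theorem continuousAt_loopPage {c : ℂ} (hc : c ≠ 0) : ContinuousAt (loopPage γ) c :=
  (continuous_angleLoop γ).continuousAt.comp (Complex.continuousAt_arg_coe_angle hc)

theorem loopPage_mul_exp {s t : ℝ} (hs : 0 < s) (ht : t ∈ Set.Icc (0 : ℝ) 1) :
    loopPage γ ((s : ℂ) * Complex.exp ((2 * Real.pi * t : ℝ) * Complex.I)) = γ.extend t := by
  rw [loopPage_eq_angleLoop, Complex.arg_real_mul _ hs, Complex.exp_mul_I, ← Complex.ofReal_cos,
    ← Complex.ofReal_sin, ← Real.Angle.cos_coe, ← Real.Angle.sin_coe,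
    Complex.arg_cos_add_sin_mul_I_coe_angle, angleLoop_coe,
    mul_div_cancel_left₀ _ Real.two_pi_pos.ne']
  rcases ht.2.lt_or_eq with h | rfl
  · rw [Int.fract_eq_self.2 ⟨ht.1, h⟩]
  · simp

end LoopPage

theorem Conf.neg_one_lt_re {n : ℕ} {P : Conf n} {z : ℂ} (hz : z ∈ P.points) : -1 < z.re := by
  obtain ⟨f, rfl⟩ := (Conf.isOpenQuotientMap_mk n).surjective P
  obtain ⟨j, rfl⟩ := hz
  exact f.2.2 j

theorem pageMap_pagePoint {W : ℂ → ℂ → ℂ} {z v : ℂ} {t : ℝ} (hz : -1 < z.re)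
    (hv : W (((1 + z.re : ℝ) : ℂ) * Complex.exp ((2 * Real.pi * t : ℝ) * Complex.I)) z = v) :
    pageMap W 1 (cylinderHomeo (pagePoint z t)) = cylinderHomeo (pagePoint (z + v) t) := by
  have h0 : 0 < 1 + z.re := by linarith
  rw [cylinderHomeo_pagePoint, cylinderHomeo_pagePoint]
  have hn : ‖((1 + z.re : ℝ) : ℂ) * Complex.exp ((2 * Real.pi * t : ℝ) * Complex.I)‖ =
      1 + z.re := by
    rw [norm_mul, Complex.norm_exp_ofReal_mul_I, mul_one, Complex.norm_real,
      Real.norm_of_nonneg h0.le]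
  generalize Complex.exp ((2 * Real.pi * t : ℝ) * Complex.I) = e at hv hn
  have hc : pageCoord (((1 + z.re : ℝ) : ℂ) * e, z.im) = z := by
    apply Complex.ext
    · simp only [pageCoord, hn]
      ring
    · rfl
  refine Prod.ext ?_ ?_
  · simp only [pageMap, hc, hv, hn]
    rw [mul_right_comm, ← Complex.ofReal_mul]
    congr 2
    rw [Complex.add_re]
    field_simp
    ring
  · simp only [pageMap, hc, hv, one_mul, Complex.add_im]

theorem continuousAt_push_loopPage {n : ℕ} {x : Conf n} (γ γ' : Path x x) (ε : ℝ) {c : ℂ}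
    (hc : c ≠ 0) (z : ℂ) :
    ContinuousAt (fun p : ℂ × ℂ => Conf.push ε (loopPage γ p.1) (loopPage γ' p.1) p.2) (c, z) := by
  have h (δ : Path x x) : ContinuousAt (fun p : ℂ × ℂ => loopPage δ p.1) (c, z) :=
    ContinuousAt.comp (f := Prod.fst) (x := (c, z)) (continuousAt_loopPage δ hc) continuousAt_fst
  have h1 : ContinuousAt (fun p : ℂ × ℂ => ((loopPage γ p.1, loopPage γ' p.1), p.2)) (c, z) :=
    ((h γ).prodMk (h γ')).prodMk continuousAt_snd
  have h2 := Conf.continuous_push (n := n) ε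
  generalize hP : (fun p : (Conf n × Conf n) × ℂ => Conf.push ε p.1.1 p.1.2 p.2) = F at h2
  have h3 : ContinuousAt (F ∘ fun p : ℂ × ℂ => ((loopPage γ p.1, loopPage γ' p.1), p.2)) (c, z) :=
    h2.continuousAt.comp h1
  rw [← hP] at h3
  exact h3

/-- Loops of configurations that are close to each other have ambient isotopic closures. -/
theorem ambientIsotopic_of_close {n : ℕ} {x : Conf n} {γ γ' : Path x x} {ε : ℝ} (hε : 0 < ε)
    (hs : ∀ t, (γ t).Separated (4 * ε)) (hc : ∀ t, (γ t).Close (ε / (n + 1)) (γ' t)) :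
    AmbientIsotopic (loopClosure γ) (loopClosure γ') := by
  -- On each page, push the configuration of the first loop to that of the second.
  let W : ℂ → ℂ → ℂ := fun c => Conf.push ε (loopPage γ c) (loopPage γ' c)
  have hdata (t : unitInterval) := exists_pushData hε (hs t) (hc t)
  have hpage (c : ℂ) : ∃ f g : OrdConf n, W c = OrdConf.push ε f g ∧ PushData ε f g := by
    obtain ⟨t, ht⟩ := exists_loopPage_eq (x := x) c
    obtain ⟨f, g, hf, hg, h⟩ := hdata t
    refine ⟨f, g, ?_, h⟩
    simp only [W, ht, ← hf, ← hg]
    rfl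
  have hW : IsPageField ε (n / (n + 1)) W := by
    refine ⟨hε, ?_, ?_, ?_, ?_, ?_, ?_⟩
    · rw [div_lt_one (by positivity)]
      linarith
    · intro c s hs
      simp only [W, loopPage, Complex.arg_mul_real hs]
    · exact fun c z hc => continuousAt_push_loopPage γ γ' ε hc z
    · intro c z w
      obtain ⟨f, g, e, h⟩ := hpage c
      rw [e]
      exact h.norm_push_sub_le z w
    · intro c z hz
      obtain ⟨f, g, e, h⟩ := hpage c
      rw [e]
      exact h.push_eq_zero hz
    · intro c z
      obtain ⟨f, g, e, h⟩ := hpage c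
      rw [e]
      exact h.norm_push_le z
  have hpt (t : unitInterval) : (γ' t).points =
      (fun z => z + Conf.push ε (γ t) (γ' t) z) '' (γ t).points := by
    obtain ⟨f, g, hf, hg, h⟩ := hdata t
    rw [← hf, ← hg]
    exact h.points_eq
  have hmap (t : unitInterval) {z : ℂ} (hz : z ∈ (γ t).points) :
      pageMap W 1 (cylinderHomeo (pagePoint z t)) =
        cylinderHomeo (pagePoint (z + Conf.push ε (γ t) (γ' t) z) t) := by
    have hre := Conf.neg_one_lt_re hz
    refine pageMap_pagePoint hre ?_
    simp only [W]
    rw [loopPage_mul_exp γ (by linarith) t.2, loopPage_mul_exp γ' (by linarith) t.2,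
      Path.extend_apply, Path.extend_apply]
  refine hW.ambientIsotopic ?_
  ext p
  constructor
  · rintro ⟨_, ⟨_, ⟨t, ht, z, hz, rfl⟩, rfl⟩, rfl⟩
    rw [γ.extend_apply ht] at hz
    refine ⟨_, ⟨t, ht, _, ?_, rfl⟩, (hmap ⟨t, ht⟩ hz).symm⟩
    rw [γ'.extend_apply ht, hpt]
    exact ⟨z, hz, rfl⟩
  · rintro ⟨_, ⟨t, ht, w, hw, rfl⟩, rfl⟩
    rw [γ'.extend_apply ht, hpt] at hw
    obtain ⟨z, hz, rfl⟩ := hw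
    refine ⟨_, ⟨_, ⟨t, ht, z, ?_, rfl⟩, rfl⟩, hmap ⟨t, ht⟩ hz⟩
    rwa [γ.extend_apply ht]

/-- Homotopic loops of configurations have ambient isotopic closures. -/
theorem ambientIsotopic_of_homotopic {n : ℕ} {x : Conf n} {γ γ' : Path x x}
    (h : γ.Homotopic γ') : AmbientIsotopic (loopClosure γ) (loopClosure γ') := by
  obtain ⟨F⟩ := h
  let f : unitInterval → IsotopyClass :=
    fun s => Quotient.mk ambientIsotopySetoid (loopClosure (F.eval s))
  -- On a neighbourhood of `s₀`, compactness of the time interval gives uniform separation and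
  -- uniform closeness, so nearby loops have isotopic closures. The parameter interval is connected.
  have hf : IsLocallyConstant f := by
    refine (IsLocallyConstant.iff_eventually_eq f).2 fun s₀ => ?_
    obtain ⟨δ, hδ, hsep⟩ := exists_separated_of_isCompact
      (isCompact_range (F.eval s₀).continuous)
    have hη : 0 < δ / 4 / (n + 1) := by positivity
    have hclose : ∀ᶠ s in 𝓝 s₀, ∀ t ∈ (Set.univ : Set unitInterval),
        (F (s₀, t)).Close (δ / 4 / (n + 1)) (F (s, t)) := by
      refine isCompact_univ.eventually_forall_of_forall_eventually fun t _ => ?_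
      have hc : Continuous fun p : unitInterval × unitInterval => (F (s₀, p.2), F (p.1, p.2)) :=
        (F.continuous.comp (continuous_const.prodMk continuous_snd)).prodMk F.continuous
      have hmem : (F (s₀, t), F (s₀, t)) ∈ {p : Conf n × Conf n | p.1.Close (δ / 4 / (n + 1)) p.2} :=
        Conf.close_refl hη _
      exact (hc.tendsto (s₀, t)).eventually ((Conf.isOpen_close (δ / 4 / (n + 1))).mem_nhds hmem)
    filter_upwards [hclose] with s hs
    refine (Quotient.sound (s := ambientIsotopySetoid)
      (ambientIsotopic_of_close (ε := δ / 4) (by positivity) (fun t => ?_) fun t => ?_)).symm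
    · rw [mul_div_cancel₀ _ (by norm_num)]
      exact hsep _ ⟨t, rfl⟩
    · exact hs t trivial
  have h01 := hf.apply_eq_of_preconnectedSpace 0 1
  simp only [f, F.eval_zero, F.eval_one] at h01
  exact Quotient.exact h01

/-! ### Straight-line homotopies of moving points. -/

/-- The two vectors lie in a common open half plane. -/
def SameSide (v w : ℂ) : Prop :=
  ∃ c : ℂ, 0 < (c * v).re ∧ 0 < (c * w).re

theorem SameSide.combo_ne_zero {v w : ℂ} (h : SameSide v w) {s : ℝ} (h0 : 0 ≤ s) (h1 : s ≤ 1) :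
    ((1 - s : ℝ) : ℂ) * v + (s : ℂ) * w ≠ 0 := by
  obtain ⟨c, hv, hw⟩ := h
  intro h
  have h2 := congrArg (fun z => (c * z).re) h
  have h3 : (c * (((1 - s : ℝ) : ℂ) * v + (s : ℂ) * w)).re =
      (1 - s) * (c * v).re + s * (c * w).re := by
    rw [mul_add, mul_left_comm, mul_left_comm c, Complex.add_re, Complex.re_ofReal_mul,
      Complex.re_ofReal_mul]
  simp only [h3, mul_zero, Complex.zero_re] at h2
  rcases h0.lt_or_eq with h | h
  · nlinarith [mul_nonneg (sub_nonneg.2 h1) hv.le, mul_pos h hw]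
  · subst h
    linarith

/-- The point of the unit circle at the angle `πu`. -/
def circleAt (u : ℝ) : ℂ := Complex.exp ((Real.pi * u : ℝ) * Complex.I)

theorem continuous_circleAt : Continuous circleAt := by
  unfold circleAt
  fun_prop

theorem norm_circleAt (u : ℝ) : ‖circleAt u‖ = 1 := Complex.norm_exp_ofReal_mul_I _

theorem circleAt_zero : circleAt 0 = 1 := by simp [circleAt]

theorem circleAt_one : circleAt 1 = -1 := by simp [circleAt]

theorem circleAt_add (u v : ℝ) : circleAt (u + v) = circleAt u * circleAt v := by
  rw [circleAt, circleAt, circleAt, ← Complex.exp_add]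
  congr 1
  push_cast
  ring

theorem re_circleAt (u : ℝ) : (circleAt u).re = Real.cos (Real.pi * u) :=
  Complex.exp_ofReal_mul_I_re _

theorem abs_re_circleAt_le (u : ℝ) : |(circleAt u).re| ≤ 1 :=
  (Complex.abs_re_le_norm _).trans (norm_circleAt u).le

theorem re_circleAt_pos {u : ℝ} (h : |u| < 1 / 2) : 0 < (circleAt u).re := by
  rw [re_circleAt]
  have h1 := abs_lt.1 h
  exact Real.cos_pos_of_mem_Ioo ⟨by nlinarith [Real.pi_pos], by nlinarith [Real.pi_pos]⟩

/-- The bisector of two directions at an angle less than π is a common positive direction. -/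
theorem sameSide_circleAt {u v r : ℝ} (h : |u - v| < 1) (hr : 0 < r) :
    SameSide (circleAt u) (r * circleAt v) := by
  have h1 := abs_lt.1 h
  refine ⟨circleAt (-(u + v) / 2), ?_, ?_⟩
  · rw [← circleAt_add]
    exact re_circleAt_pos (abs_lt.2 ⟨by linarith, by linarith⟩)
  · rw [mul_left_comm, Complex.re_ofReal_mul, ← circleAt_add]
    exact mul_pos hr (re_circleAt_pos (abs_lt.2 ⟨by linarith, by linarith⟩))

theorem sameSide_circleAt' {u v : ℝ} (h : |u - v| < 1) : SameSide (circleAt u) (circleAt v) := by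
  simpa using sameSide_circleAt h one_pos

/-- The test direction has angle π/3: there 3/2 contributes 3/4, which exceeds the perturbation 1/2,
and angles in [0, 3π/4] differ from it by less than π/2. -/
theorem sameSide_right {η : ℂ} (hη : ‖η‖ ≤ 1 / 2) {v r : ℝ} (h0 : 0 ≤ v) (h1 : v ≤ 3 / 4)
    (hr : 0 < r) : SameSide (3 / 2 + η) (r * circleAt v) := by
  refine ⟨circleAt (-(1 / 3)), ?_, ?_⟩
  · have h2 : (circleAt (-(1 / 3))).re = 1 / 2 := by
      rw [re_circleAt, mul_neg, Real.cos_neg, mul_one_div, Real.cos_pi_div_three]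
    have h3 : ‖circleAt (-(1 / 3)) * η‖ ≤ 1 / 2 := by rwa [norm_mul, norm_circleAt, one_mul]
    have h4 := (abs_le.1 ((Complex.abs_re_le_norm _).trans h3)).1
    have h5 : (circleAt (-(1 / 3)) * (3 / 2 + η)).re =
        3 / 2 * (circleAt (-(1 / 3))).re + (circleAt (-(1 / 3)) * η).re := by
      rw [mul_add, Complex.add_re, mul_comm _ (3 / 2 : ℂ)]
      congr 1
      rw [← Complex.re_ofReal_mul]
      norm_num
    rw [h5, h2]
    linarith
  · rw [mul_left_comm, Complex.re_ofReal_mul, ← circleAt_add]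
    exact mul_pos hr (re_circleAt_pos (abs_lt.2 ⟨by linarith, by linarith⟩))

/-- The test direction has angle 2π/3: there -3/2 contributes 3/4, and angles in [π/2, π] differ
from it by less than π/2. -/
theorem sameSide_left {η : ℂ} (hη : ‖η‖ ≤ 1 / 2) {v r : ℝ} (h0 : 1 / 2 ≤ v) (h1 : v ≤ 1)
    (hr : 0 < r) : SameSide (-3 / 2 + η) (r * circleAt v) := by
  refine ⟨circleAt (-(2 / 3)), ?_, ?_⟩
  · have h2 : (circleAt (-(2 / 3))).re = -(1 / 2) := by
      rw [re_circleAt, mul_neg, Real.cos_neg,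
        show Real.pi * (2 / 3) = Real.pi - Real.pi / 3 by ring, Real.cos_pi_sub,
        Real.cos_pi_div_three]
    have h3 : ‖circleAt (-(2 / 3)) * η‖ ≤ 1 / 2 := by rwa [norm_mul, norm_circleAt, one_mul]
    have h4 := (abs_le.1 ((Complex.abs_re_le_norm _).trans h3)).1
    have h5 : (circleAt (-(2 / 3)) * (-3 / 2 + η)).re =
        -3 / 2 * (circleAt (-(2 / 3))).re + (circleAt (-(2 / 3)) * η).re := by
      rw [mul_add, Complex.add_re, mul_comm _ (-3 / 2 : ℂ)]
      congr 1
      rw [← Complex.re_ofReal_mul]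
      norm_num
    rw [h5, h2]
    linarith
  · rw [mul_left_comm, Complex.re_ofReal_mul, ← circleAt_add]
    exact mul_pos hr (re_circleAt_pos (abs_lt.2 ⟨by linarith, by linarith⟩))

/-- The path of configurations consists of the first `n` of the moving points. -/
def IsTrackOf {n : ℕ} {x y : Conf n} (A : ℝ → ℕ → ℂ) (p : Path x y) : Prop :=
  ∀ t : unitInterval, ∃ f : OrdConf n, Conf.mk f = p t ∧ ∀ j : Fin n, f.1 j = A t j

/-- One system of moving points followed by another one. -/
def concatTrack (A B : ℝ → ℕ → ℂ) (t : ℝ) (j : ℕ) : ℂ :=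
  if t ≤ 1 / 2 then A (2 * t) j else B (2 * t - 1) j

theorem IsTrackOf.concat {n : ℕ} {x y z : Conf n} {A B : ℝ → ℕ → ℂ} {p : Path x y}
    {q : Path y z} (hA : IsTrackOf A p) (hB : IsTrackOf B q) :
    IsTrackOf (concatTrack A B) (p.trans q) := by
  intro t
  rw [Path.trans_apply]
  unfold concatTrack
  by_cases h : (t : ℝ) ≤ 1 / 2
  · simpa only [h, dif_pos, if_true] using hA ⟨2 * t, _⟩
  · simpa only [h, dif_neg, if_false, not_false_eq_true] using hB ⟨2 * t - 1, _⟩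

/-- Configurations are unordered, so a motion may be relabelled. This lets the second letter of a
product be followed by the labels that the first one leaves behind. -/
theorem IsTrackOf.permute {n : ℕ} {x y : Conf n} {A : ℝ → ℕ → ℂ} {p : Path x y}
    (hA : IsTrackOf A p) {σ : ℕ → ℕ} (hσ : ∀ j < n, σ j < n) (hinj : Function.Injective σ) :
    IsTrackOf (fun t j => A t (σ j)) p := by
  intro t
  obtain ⟨f, hf, h⟩ := hA t
  have hτ : Function.Injective fun j : Fin n => (⟨σ j, hσ j j.2⟩ : Fin n) :=
    fun i j hij => Fin.ext (hinj (Fin.mk.inj hij))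
  let τ : Equiv.Perm (Fin n) := Equiv.ofBijective _ (Finite.injective_iff_bijective.1 hτ)
  refine ⟨⟨f.1 ∘ τ, f.2.1.comp τ.injective, fun j => f.2.2 (τ j)⟩, ?_, fun j => h (τ j)⟩
  rw [← hf]
  exact (Conf.mk_eq_iff.2 ⟨τ, fun j => rfl⟩).symm

theorem continuous_concatTrack {A B : ℝ → ℕ → ℂ} (hA : ∀ j, Continuous fun t => A t j)
    (hB : ∀ j, Continuous fun t => B t j) (hAB : ∀ j, A 1 j = B 0 j) (j : ℕ) :
    Continuous fun t => concatTrack A B t j := by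
  refine Continuous.if_le ((hA j).comp (continuous_const.mul continuous_id))
    ((hB j).comp ((continuous_const.mul continuous_id).sub continuous_const))
    continuous_id continuous_const fun t ht => ?_
  rw [ht]
  norm_num [hAB]

/-- The `j`-th moving point stays in the vertical strip between `lo j` and `hi j`. -/
def StaysIn (lo hi : ℕ → ℕ) (A : ℝ → ℕ → ℂ) : Prop :=
  ∀ t j, (lo j : ℝ) ≤ (A t j).re ∧ (A t j).re ≤ hi j

theorem StaysIn.concat {lo hi : ℕ → ℕ} {A B : ℝ → ℕ → ℂ} (hA : StaysIn lo hi A)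
    (hB : StaysIn lo hi B) : StaysIn lo hi (concatTrack A B) := by
  intro t j
  unfold concatTrack
  split_ifs
  · exact hA _ _
  · exact hB _ _

theorem StaysIn.permute {lo hi lo' hi' : ℕ → ℕ} {A : ℝ → ℕ → ℂ} (hA : StaysIn lo hi A) {σ : ℕ → ℕ}
    (hlo : ∀ j, lo' j ≤ lo (σ j)) (hhi : ∀ j, hi (σ j) ≤ hi' j) :
    StaysIn lo' hi' fun t j => A t (σ j) :=
  fun t j => ⟨(Nat.cast_le.2 (hlo j)).trans (hA t _).1, (hA t _).2.trans (Nat.cast_le.2 (hhi j))⟩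

/-- Straight line homotopy between systems of moving points whose difference vectors are never
antipodal. -/
theorem IsTrackOf.exists_homotopic {n : ℕ} {x y : Conf n} {A B : ℝ → ℕ → ℂ} {p : Path x y}
    {lo hi : ℕ → ℕ} (hp : IsTrackOf A p) (hA : ∀ j, Continuous fun t => A t j)
    (hB : ∀ j, Continuous fun t => B t j) (h0 : ∀ j, A 0 j = B 0 j) (h1 : ∀ j, A 1 j = B 1 j)
    (hAs : StaysIn lo hi A) (hBs : StaysIn lo hi B)
    (hside : ∀ t ∈ Set.Icc (0 : ℝ) 1, ∀ j k, j < k → lo k ≤ hi j →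
      SameSide (A t k - A t j) (B t k - B t j)) :
    ∃ q : Path x y, IsTrackOf B q ∧ p.Homotopic q := by
  -- Points in disjoint vertical strips are ordered by real part in both motions, so direction 1
  -- serves for them; the hypothesis is needed only for overlapping strips.
  have hside' : ∀ t ∈ Set.Icc (0 : ℝ) 1, ∀ j k, j < k →
      SameSide (A t k - A t j) (B t k - B t j) := by
    intro t ht j k hjk
    rcases lt_or_ge (hi j) (lo k) with h | h
    · have h' : (hi j : ℝ) < lo k := Nat.cast_lt.2 h
      refine ⟨1, ?_, ?_⟩
      · rw [one_mul, Complex.sub_re]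
        linarith [(hAs t k).1, (hAs t j).2]
      · rw [one_mul, Complex.sub_re]
        linarith [(hBs t k).1, (hBs t j).2]
    · exact hside t ht j k hjk h
  let C : unitInterval → unitInterval → Fin n → ℂ := fun s t j =>
    ((1 - s : ℝ) : ℂ) * A t j + ((s : ℝ) : ℂ) * B t j
  have hne (s t : unitInterval) {j k : Fin n} (hjk : j < k) : C s t j ≠ C s t k := by
    intro h
    refine (hside' t t.2 j k hjk).combo_ne_zero s.2.1 s.2.2 ?_
    simp only [C] at h
    linear_combination -h
  have hC (s t : unitInterval) : Function.Injective (C s t) ∧ ∀ j, -1 < (C s t j).re := by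
    refine ⟨fun j k h => ?_, fun j => ?_⟩
    · rcases lt_trichotomy j k with hjk | hjk | hjk
      · exact absurd h (hne s t hjk)
      · exact hjk
      · exact absurd h.symm (hne s t hjk)
    · simp only [C, Complex.add_re, Complex.re_ofReal_mul]
      have h2 := (Nat.cast_nonneg (α := ℝ) (lo j)).trans (hAs t j).1
      have h3 := (Nat.cast_nonneg (α := ℝ) (lo j)).trans (hBs t j).1
      have h4 := mul_nonneg (sub_nonneg.2 s.2.2) h2
      have h5 := mul_nonneg s.2.1 h3
      linarith
  let F : unitInterval × unitInterval → Conf n := fun r => Conf.mk ⟨C r.1 r.2, hC r.1 r.2⟩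
  have hF : Continuous F := by
    refine Conf.continuous_mk.comp (Continuous.subtype_mk (continuous_pi fun j => ?_) _)
    have hA' : Continuous fun r : unitInterval × unitInterval => A r.2 j :=
      (hA j).comp (continuous_subtype_val.comp continuous_snd)
    have hB' : Continuous fun r : unitInterval × unitInterval => B r.2 j :=
      (hB j).comp (continuous_subtype_val.comp continuous_snd)
    have hs : Continuous fun r : unitInterval × unitInterval => (r.1 : ℝ) :=
      continuous_subtype_val.comp continuous_fst
    exact ((Complex.continuous_ofReal.comp (continuous_const.sub hs)).mul hA').add
      ((Complex.continuous_ofReal.comp hs).mul hB')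
  have hFp (s t : unitInterval) (h : ∀ j : Fin n, C s t j = A t j) : F (s, t) = p t := by
    obtain ⟨f, hf, hfA⟩ := hp t
    rw [← hf]
    exact congrArg Conf.mk (Subtype.ext (funext fun j => (h j).trans (hfA j).symm))
  have hzero (s : unitInterval) : F (s, 0) = p 0 := hFp s 0 fun j => by
    simp only [C, Set.Icc.coe_zero, ← h0]
    push_cast
    ring
  have hone (s : unitInterval) : F (s, 1) = p 1 := hFp s 1 fun j => by
    simp only [C, Set.Icc.coe_one, ← h1]
    push_cast
    ring
  refine ⟨⟨⟨fun t => F (1, t), hF.comp (continuous_const.prodMk continuous_id)⟩,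
    (hzero 1).trans p.source, (hone 1).trans p.target⟩, fun t => ⟨_, rfl, fun j => ?_⟩,
    ⟨⟨⟨⟨F, hF⟩, fun t => ?_, fun t => rfl⟩, ?_⟩⟩⟩
  · simp [C]
  · exact hFp 0 t fun j => by simp [C]
  · rintro s t (rfl | rfl)
    · exact hzero s
    · exact hone s

/-- A path is determined by its track, so two homotopies that end in the same motion end in the same
path. -/
theorem IsTrackOf.eq {n : ℕ} {x y : Conf n} {A : ℝ → ℕ → ℂ} {p q : Path x y}
    (hp : IsTrackOf A p) (hq : IsTrackOf A q) : p = q := by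
  ext t
  obtain ⟨f, hf, hfA⟩ := hp t
  obtain ⟨g, hg, hgA⟩ := hq t
  rw [← hf, ← hg]
  exact congrArg Conf.mk (Subtype.ext (funext fun j => (hfA j).trans (hgA j).symm))

/-! ### Half turns and the loops of letters. -/

/-- The points `0, 1, 2, …` of the real axis, of which `i` and `i + 1` exchange their places by a
half turn around each other. -/
def halfTurn (i : ℕ) (u : ℝ) (j : ℕ) : ℂ :=
  if j = i then i + 1 / 2 - circleAt u / 2 else if j = i + 1 then i + 1 / 2 + circleAt u / 2 else j

/-- The transposition of `i` and `i + 1`. -/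
def swapAt (i j : ℕ) : ℕ :=
  if j = i then i + 1 else if j = i + 1 then i else j

theorem swapAt_injective (i : ℕ) : Function.Injective (swapAt i) := by
  intro j k h
  unfold swapAt at h
  split_ifs at h <;> omega

theorem swapAt_lt {n i j : ℕ} (hi : i + 1 < n) (hj : j < n) : swapAt i j < n := by
  unfold swapAt
  split_ifs <;> omega

theorem circleAt_neg_one : circleAt (-1) = -1 := by
  have h := circleAt_add (-1) 1
  rw [circleAt_one, neg_add_cancel, circleAt_zero] at h
  linear_combination h

theorem halfTurn_zero (i j : ℕ) : halfTurn i 0 j = j := by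
  unfold halfTurn
  rw [circleAt_zero]
  split_ifs with h1 h2
  · rw [h1]
    ring
  · rw [h2]
    push_cast
    ring
  · rfl

theorem halfTurn_of_circleAt_eq {i j : ℕ} {u : ℝ} (hu : circleAt u = -1) :
    halfTurn i u j = swapAt i j := by
  unfold halfTurn swapAt
  rw [hu]
  split_ifs with h1 h2
  · push_cast
    ring
  · ring
  · rfl

theorem halfTurn_one (i j : ℕ) : halfTurn i 1 j = swapAt i j :=
  halfTurn_of_circleAt_eq circleAt_one

theorem continuous_halfTurn (i j : ℕ) : Continuous fun u => halfTurn i u j := by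
  have := continuous_circleAt
  unfold halfTurn
  split_ifs <;> fun_prop

theorem staysIn_halfTurn (i : ℕ) :
    StaysIn (fun j => if j = i + 1 then i else j) (fun j => if j = i then i + 1 else j)
      (halfTurn i) := by
  intro u j
  have h := abs_le.1 (abs_re_circleAt_le u)
  unfold halfTurn
  have h2 : (circleAt u / 2).re = (circleAt u).re / 2 := by simp
  have h3 : ((i : ℂ) + 1 / 2).re = i + 1 / 2 := by simp
  rcases (show j = i ∨ j = i + 1 ∨ (j ≠ i ∧ j ≠ i + 1) by omega) with rfl | rfl | ⟨h4, h5⟩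
  · simp only [if_true, Nat.left_eq_add, one_ne_zero, if_false, Complex.sub_re, h2, h3]
    push_cast
    constructor <;> linarith
  · simp only [if_true, Nat.add_eq_left, one_ne_zero, if_false]
    rw [Complex.add_re, h2, h3]
    push_cast
    constructor <;> linarith
  · simp [h4, h5]

theorem halfTurn_injective (i : ℕ) (u : ℝ) : Function.Injective (halfTurn i u) := by
  have hlt : ∀ j k : ℕ, j < k → halfTurn i u j ≠ halfTurn i u k := by
    intro j k hjk h
    by_cases hc : j = i ∧ k = i + 1
    · obtain ⟨rfl, rfl⟩ := hc
      simp only [halfTurn, if_true, Nat.add_eq_left, one_ne_zero, if_false] at h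
      have h0 : circleAt u = 0 := by linear_combination -h
      have := norm_circleAt u
      rw [h0, norm_zero] at this
      exact zero_ne_one this
    · have h1 := (staysIn_halfTurn i u j).2
      have h2 := (staysIn_halfTurn i u k).1
      rw [h] at h1
      have h3 := Nat.cast_le.1 (h2.trans h1)
      simp only at h3
      split_ifs at h3 <;> omega
  intro j k h
  rcases lt_trichotomy j k with hjk | hjk | hjk
  · exact absurd h (hlt j k hjk)
  · exact hjk
  · exact absurd h.symm (hlt k j hjk)

theorem stringPosition_some {n : ℕ} (i : Fin (n - 1)) (b : Bool) (j : ℕ) (u : ℝ) :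
    stringPosition (some (i, b)) j u = halfTurn i (if b then u else -u) j := by
  have h : Complex.exp ((if b then 1 else -1) * Real.pi * u * Complex.I) =
      circleAt (if b then u else -u) := by
    unfold circleAt
    congr 1
    cases b <;> push_cast <;> simp
  simp only [stringPosition, h, halfTurn]

theorem stringPosition_none {n : ℕ} (j : ℕ) (u : ℝ) :
    stringPosition (none : Option (Fin (n - 1) × Bool)) j u = j := rfl

theorem stringPosition_injective {n : ℕ} (o : Option (Fin (n - 1) × Bool)) (u : ℝ) :
    Function.Injective fun j : Fin n => stringPosition o j u := by
  intro j k h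
  apply Fin.ext
  rcases o with _ | ⟨i, b⟩
  · simpa [stringPosition] using h
  · simp only [stringPosition_some] at h
    exact halfTurn_injective _ _ h

theorem neg_one_lt_re_stringPosition {n : ℕ} (o : Option (Fin (n - 1) × Bool)) (u : ℝ) (j : ℕ) :
    -1 < (stringPosition o j u).re := by
  rcases o with _ | ⟨i, b⟩
  · simp only [stringPosition, Complex.natCast_re]
    linarith [j.cast_nonneg (α := ℝ)]
  · rw [stringPosition_some]
    exact neg_one_lt_zero.trans_le
      ((Nat.cast_nonneg (α := ℝ) _).trans (staysIn_halfTurn i _ j).1)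

/-- The strings in one sector of a closed braid. -/
def stringConf {n : ℕ} (o : Option (Fin (n - 1) × Bool)) (u : ℝ) : OrdConf n :=
  ⟨fun j => stringPosition o j u, stringPosition_injective o u,
    fun j => neg_one_lt_re_stringPosition o u j⟩

/-- The configuration of the points `0, 1, …, n - 1`. -/
def baseConf (n : ℕ) : Conf n := Conf.mk (stringConf none 0)

theorem continuous_stringConf {n : ℕ} (o : Option (Fin (n - 1) × Bool)) :
    Continuous (stringConf o : ℝ → OrdConf n) := by
  refine Continuous.subtype_mk (continuous_pi fun j => ?_) _
  rcases o with _ | ⟨i, b⟩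
  · exact continuous_const
  · simp only [stringPosition_some]
    cases b
    · exact (continuous_halfTurn i j).comp continuous_neg
    · exact continuous_halfTurn i j

theorem mk_stringConf_zero {n : ℕ} (x : Fin (n - 1) × Bool) :
    Conf.mk (stringConf (some x) 0) = baseConf n := by
  refine congrArg Conf.mk (Subtype.ext (funext fun j => ?_))
  obtain ⟨i, b⟩ := x
  simp [stringConf, stringPosition_some, halfTurn_zero, stringPosition_none]

theorem mk_stringConf_one {n : ℕ} (x : Fin (n - 1) × Bool) :
    Conf.mk (stringConf (some x) 1) = baseConf n := by
  obtain ⟨i, b⟩ := x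
  have hi : (i : ℕ) + 1 < n := by omega
  have hτ : Function.Injective fun j : Fin n => (⟨swapAt i j, swapAt_lt hi j.2⟩ : Fin n) :=
    fun j k h => Fin.ext (swapAt_injective i (Fin.mk.inj h))
  refine (Conf.mk_eq_iff.2 ⟨Equiv.ofBijective _ (Finite.injective_iff_bijective.1 hτ),
    fun j => ?_⟩).symm
  simp only [stringConf, stringPosition_some, stringPosition_none, Equiv.ofBijective_apply]
  refine halfTurn_of_circleAt_eq ?_
  cases b
  · exact circleAt_neg_one
  · exact circleAt_one

/-- The loop of configurations of a letter. -/
def letterLoop {n : ℕ} (x : Fin (n - 1) × Bool) : Path (baseConf n) (baseConf n) where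
  toFun u := Conf.mk (stringConf (some x) u)
  continuous_toFun :=
    Conf.continuous_mk.comp ((continuous_stringConf _).comp continuous_subtype_val)
  source' := mk_stringConf_zero x
  target' := mk_stringConf_one x

theorem letterLoop_apply {n : ℕ} (x : Fin (n - 1) × Bool) (u : unitInterval) :
    letterLoop x u = Conf.mk (stringConf (some x) u) := rfl

theorem isTrackOf_letterLoop {n : ℕ} (i : Fin (n - 1)) :
    IsTrackOf (halfTurn i) (letterLoop (i, true)) := fun u =>
  ⟨_, rfl, fun j => by simp [stringConf, stringPosition_some]⟩

/-- The clockwise half turn is the reversed counterclockwise one with the two labels exchanged: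
`circleAt (1 - t) = -circleAt (-t)`. -/
theorem letterLoop_false {n : ℕ} (i : Fin (n - 1)) :
    letterLoop (i, false) = (letterLoop (i, true)).symm := by
  have h1 : IsTrackOf (fun t => halfTurn i (-t)) (letterLoop (i, false)) := fun u =>
    ⟨_, rfl, fun j => by simp [stringConf, stringPosition_some]⟩
  have h2 : IsTrackOf (fun t => halfTurn i (1 - t)) (letterLoop (i, true)).symm := fun u =>
    ⟨_, rfl, fun j => by simp [stringConf, stringPosition_some]⟩
  have h3 := h2.permute (σ := swapAt i) (fun j hj => swapAt_lt (by omega) hj) (swapAt_injective i)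
  have h4 : (fun (t : ℝ) (j : ℕ) => halfTurn i (1 - t) (swapAt i j)) = fun t => halfTurn i (-t) := by
    funext t j
    have h5 : circleAt (1 - t) = -circleAt (-t) := by
      rw [sub_eq_add_neg, circleAt_add, circleAt_one, neg_one_mul]
    unfold halfTurn swapAt
    rw [h5]
    split_ifs <;> first | omega | ring
  rw [h4] at h3
  exact h1.eq h3

/-! ### The commutation and braid relations as homotopies. -/

/-- Half turns of the pairs `i, i + 1` and `k, k + 1` at the same time. -/
def doubleTurn (i k : ℕ) (t : ℝ) (j : ℕ) : ℂ :=
  if j = i ∨ j = i + 1 then halfTurn i t j else halfTurn k t j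

theorem doubleTurn_comm {i k : ℕ} (h : i + 2 ≤ k ∨ k + 2 ≤ i) : doubleTurn i k = doubleTurn k i := by
  funext t j
  unfold doubleTurn halfTurn
  split_ifs <;> first | rfl | omega

theorem continuous_doubleTurn (i k j : ℕ) : Continuous fun t => doubleTurn i k t j := by
  unfold doubleTurn
  split_ifs
  · exact continuous_halfTurn i j
  · exact continuous_halfTurn k j

/-- Two distant half turns one after the other can be performed at the same time. -/
theorem exists_homotopic_doubleTurn {n : ℕ} (i k : Fin (n - 1))
    (hik : (i : ℕ) + 2 ≤ k ∨ (k : ℕ) + 2 ≤ i) :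
    ∃ q : Path (baseConf n) (baseConf n), IsTrackOf (doubleTurn i k) q ∧
      ((letterLoop (i, true)).trans (letterLoop (k, true))).Homotopic q := by
  have hp := (isTrackOf_letterLoop i).concat ((isTrackOf_letterLoop k).permute (σ := swapAt i)
    (fun j hj => swapAt_lt (by omega) hj) (swapAt_injective i))
  generalize (i : ℕ) = i at hik hp
  generalize (k : ℕ) = k at hik hp
  refine hp.exists_homotopic (lo := fun j => if j = i + 1 then i else if j = k + 1 then k else j)
    (hi := fun j => if j = i then i + 1 else if j = k then k + 1 else j)
    (fun j => continuous_concatTrack (continuous_halfTurn i) (fun j => continuous_halfTurn k _)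
      (fun j => by rw [halfTurn_one, halfTurn_zero]) j) (continuous_doubleTurn i k) ?_ ?_ ?_ ?_ ?_
  · intro j
    simp [concatTrack, doubleTurn, halfTurn_zero]
  · intro j
    have h : (2 : ℝ) * 1 - 1 = 1 := by norm_num
    rw [concatTrack, if_neg (by norm_num), h, doubleTurn, halfTurn_one, halfTurn_one, halfTurn_one]
    unfold swapAt
    split_ifs <;> first | rfl | omega
  · refine StaysIn.concat ?_ ((staysIn_halfTurn k).permute ?_ ?_)
    · refine (staysIn_halfTurn i).permute (σ := id) ?_ ?_
      · intro j
        simp only [id]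
        split_ifs <;> omega
      · intro j
        simp only [id]
        split_ifs <;> omega
    · intro j
      unfold swapAt
      split_ifs <;> omega
    · intro j
      unfold swapAt
      split_ifs <;> omega
  · intro t j
    unfold doubleTurn
    split_ifs with h1
    · have h := staysIn_halfTurn i t j
      refine ⟨(Nat.cast_le.2 ?_).trans h.1, h.2.trans (Nat.cast_le.2 ?_)⟩ <;> dsimp only <;> split_ifs <;> omega
    · have h := staysIn_halfTurn k t j
      refine ⟨(Nat.cast_le.2 ?_).trans h.1, h.2.trans (Nat.cast_le.2 ?_)⟩ <;> dsimp only <;> split_ifs <;> omega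
  · intro t ht j l hjl hlo
    -- Only the two exchanging pairs have overlapping strips. In both motions their differences are
    -- points of the unit circle, and the angles differ by less than π.
    have hcase : (j = i ∧ l = i + 1) ∨ (j = k ∧ l = k + 1) := by
      split_ifs at hlo <;> omega
    have h1 := ht.1
    have h2 := ht.2
    have n1 : ¬ k = i := by omega
    have n2 : ¬ k = i + 1 := by omega
    have n3 : ¬ k + 1 = i := by omega
    have n4 : ¬ i = k := by omega
    have n5 : ¬ i = k + 1 := by omega
    have n6 : ¬ i + 1 = k := by omega
    rcases le_or_gt t (1 / 2) with h | h
    · have hc (j : ℕ) : concatTrack (halfTurn i) (fun t j => halfTurn k t (swapAt i j)) t j =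
          halfTurn i (2 * t) j := if_pos h
      rw [hc, hc]
      rcases hcase with ⟨rfl, rfl⟩ | ⟨rfl, rfl⟩
      · convert sameSide_circleAt' (u := 2 * t) (v := t) (abs_lt.2 ⟨by linarith, by linarith⟩)
          using 1 <;> simp [doubleTurn, halfTurn]
      · convert sameSide_circleAt' (u := 0) (v := t) (abs_lt.2 ⟨by linarith, by linarith⟩)
          using 1 <;> simp [doubleTurn, halfTurn, circleAt_zero, n1, n2, n3]
    · have hc (j : ℕ) : concatTrack (halfTurn i) (fun t j => halfTurn k t (swapAt i j)) t j =
          halfTurn k (2 * t - 1) (swapAt i j) := if_neg (not_le.2 h)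
      rw [hc, hc]
      rcases hcase with ⟨rfl, rfl⟩ | ⟨rfl, rfl⟩
      · convert sameSide_circleAt' (u := 1) (v := t) (abs_lt.2 ⟨by linarith, by linarith⟩)
          using 1 <;> simp [doubleTurn, halfTurn, swapAt, circleAt_one, n4, n5, n6]
      · convert sameSide_circleAt' (u := 2 * t - 1) (v := t)
          (abs_lt.2 ⟨by linarith, by linarith⟩)
          using 1 <;> simp [doubleTurn, halfTurn, swapAt, n1, n2, n3]

/-- The rigid half turn of the points `i, i + 1, i + 2`. -/
def rigidTurn (i : ℕ) (t : ℝ) (j : ℕ) : ℂ :=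
  if j = i then i + 1 - circleAt t else if j = i + 1 then i + 1 else
    if j = i + 2 then i + 1 + circleAt t else j

theorem continuous_rigidTurn (i j : ℕ) : Continuous fun t => rigidTurn i t j := by
  have := continuous_circleAt
  unfold rigidTurn
  split_ifs <;> fun_prop

theorem rigidTurn_zero (i j : ℕ) : rigidTurn i 0 j = j := by
  unfold rigidTurn
  rw [circleAt_zero]
  split_ifs with h1 h2 h3
  · rw [h1]
    ring
  · rw [h2]
    push_cast
    ring
  · rw [h3]
    push_cast
    ring
  · rfl

theorem rigidTurn_one (i j : ℕ) :
    rigidTurn i 1 j = (if j = i then i + 2 else if j = i + 2 then i else j : ℕ) := by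
  unfold rigidTurn
  rw [circleAt_one]
  split_ifs with h1 h2 h3 h4
  · push_cast
    ring
  · omega
  · rw [h2]
    push_cast
    ring
  · ring
  · rfl

theorem staysIn_rigidTurn (i : ℕ) :
    StaysIn (fun j => if j = i + 1 ∨ j = i + 2 then i else j)
      (fun j => if j = i ∨ j = i + 1 then i + 2 else j) (rigidTurn i) := by
  intro t j
  have h := abs_le.1 (abs_re_circleAt_le t)
  have h3 : ((i : ℂ) + 1).re = i + 1 := by simp
  unfold rigidTurn
  rcases (show j = i ∨ j = i + 1 ∨ j = i + 2 ∨ (j ≠ i ∧ j ≠ i + 1 ∧ j ≠ i + 2) by omega) with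
    rfl | rfl | rfl | ⟨h4, h5, h6⟩
  · simp only [if_true, Nat.left_eq_add, one_ne_zero, OfNat.ofNat_ne_zero, or_self, true_or,
      if_false]
    rw [Complex.sub_re, h3]
    push_cast
    constructor <;> linarith
  · simp only [if_true, Nat.add_eq_left, one_ne_zero, true_or, or_true, if_false]
    rw [h3]
    push_cast
    constructor <;> linarith
  · simp only [if_true, Nat.add_eq_left, OfNat.ofNat_ne_zero, or_true, if_false,
      Nat.add_left_cancel_iff, OfNat.ofNat_ne_one, or_self]
    rw [Complex.add_re, h3]
    push_cast
    constructor <;> linarith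
  · simp [h4, h5, h6]

/-- The moving points of `σ_i σ_k σ_i`. -/
def tripleTurn (i k : ℕ) : ℝ → ℕ → ℂ :=
  concatTrack (halfTurn i) (concatTrack (fun t j => halfTurn k t (swapAt i j))
    fun t j => halfTurn i t (swapAt k (swapAt i j)))

theorem isTrackOf_tripleTurn {n : ℕ} (i k : Fin (n - 1)) :
    IsTrackOf (tripleTurn i k) ((letterLoop (i, true)).trans
      ((letterLoop (k, true)).trans (letterLoop (i, true)) : Path (baseConf n) (baseConf n))) :=
  (isTrackOf_letterLoop i).concat
    (((isTrackOf_letterLoop k).permute (σ := swapAt i) (fun j hj => swapAt_lt (by omega) hj)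
      (swapAt_injective i)).concat
    ((isTrackOf_letterLoop i).permute (σ := swapAt k ∘ swapAt i)
      (fun j hj => swapAt_lt (by omega) (swapAt_lt (by omega) hj))
      ((swapAt_injective k).comp (swapAt_injective i))))

theorem continuous_tripleTurn (i k j : ℕ) : Continuous fun t => tripleTurn i k t j := by
  refine continuous_concatTrack (continuous_halfTurn i) (continuous_concatTrack
    (fun j => continuous_halfTurn k _) (fun j => continuous_halfTurn i _) fun j => ?_)
    (fun j => ?_) j
  · rw [halfTurn_one, halfTurn_zero]
  · rw [concatTrack, if_pos (by norm_num), mul_zero, halfTurn_one, halfTurn_zero]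

theorem tripleTurn_zero (i k j : ℕ) : tripleTurn i k 0 j = j := by
  rw [tripleTurn, concatTrack, if_pos (by norm_num), mul_zero, halfTurn_zero]

theorem tripleTurn_one (i k j : ℕ) :
    tripleTurn i k 1 j = swapAt i (swapAt k (swapAt i j)) := by
  have h : (2 : ℝ) * 1 - 1 = 1 := by norm_num
  rw [tripleTurn, concatTrack, if_neg (by norm_num), h, concatTrack, if_neg (by norm_num), h,
    halfTurn_one]

theorem staysIn_tripleTurn {i k l : ℕ} (hi : i = l ∨ i = l + 1) (hk : k = l ∨ k = l + 1) :
    StaysIn (fun j => if j = l + 1 ∨ j = l + 2 then l else j)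
      (fun j => if j = l ∨ j = l + 1 then l + 2 else j) (tripleTurn i k) := by
  have h {m : ℕ} (hm : m = l ∨ m = l + 1) (σ : ℕ → ℕ)
      (hσ : ∀ j, (l ≤ j ∧ j ≤ l + 2 ∧ l ≤ σ j ∧ σ j ≤ l + 2) ∨
        (¬ (l ≤ j ∧ j ≤ l + 2) ∧ σ j = j)) :
      StaysIn (fun j => if j = l + 1 ∨ j = l + 2 then l else j)
        (fun j => if j = l ∨ j = l + 1 then l + 2 else j) fun t j => halfTurn m t (σ j) := by
    refine (staysIn_halfTurn m).permute (fun j => ?_) fun j => ?_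
    · have := hσ j
      split_ifs <;> omega
    · have := hσ j
      split_ifs <;> omega
  refine (h hi id fun j => by rw [id_eq]; omega).concat
    ((h hk (swapAt i) fun j => ?_).concat (h hi (swapAt k ∘ swapAt i) fun j => ?_))
  · unfold swapAt
    split_ifs <;> omega
  · simp only [Function.comp_apply]
    unfold swapAt
    split_ifs <;> omega

theorem tripleTurn_of_le {i k j : ℕ} {t : ℝ} (h : t ≤ 1 / 2) :
    tripleTurn i k t j = halfTurn i (2 * t) j := if_pos h

theorem tripleTurn_of_mem {i k j : ℕ} {t : ℝ} (h : 1 / 2 < t) (h' : t ≤ 3 / 4) :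
    tripleTurn i k t j = halfTurn k (4 * t - 2) (swapAt i j) := by
  rw [tripleTurn, concatTrack, if_neg (not_le.2 h), concatTrack, if_pos (by linarith)]
  congr 1
  ring

theorem tripleTurn_of_lt {i k j : ℕ} {t : ℝ} (h : 3 / 4 < t) :
    tripleTurn i k t j = halfTurn i (4 * t - 3) (swapAt k (swapAt i j)) := by
  rw [tripleTurn, concatTrack, if_neg (by linarith), concatTrack, if_neg (by linarith)]
  congr 1
  ring

theorem norm_circleAt_half (u : ℝ) : ‖circleAt u / 2‖ ≤ 1 / 2 := by
  rw [norm_div, norm_circleAt]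
  norm_num

theorem norm_neg_circleAt_half (u : ℝ) : ‖-(circleAt u / 2)‖ ≤ 1 / 2 := by
  rw [norm_neg]
  exact norm_circleAt_half u

/-- In the rigid turn each difference is a positive multiple of `circleAt t`. In the triple turn the
pair currently exchanging has a unit difference whose angle is within π of it. Any other pair has
difference ±3/2 + η with ‖η‖ ≤ 1/2, the sign telling whether that pair has already exchanged: plus
occurs only for t ≤ 3/4, minus only for t > 1/2. -/
theorem sameSide_tripleTurn {i k l a b : ℕ} (hik : (i = l ∧ k = l + 1) ∨ (i = l + 1 ∧ k = l))
    (hab : (a = l ∧ b = l + 1) ∨ (a = l ∧ b = l + 2) ∨ (a = l + 1 ∧ b = l + 2)) {t : ℝ}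
    (ht : t ∈ Set.Icc (0 : ℝ) 1) :
    SameSide (tripleTurn i k t b - tripleTurn i k t a) (rigidTurn l t b - rigidTurn l t a) := by
  have h0 := ht.1
  have h1 := ht.2
  have t1 (u : ℝ) : halfTurn l u l = l + 1 / 2 - circleAt u / 2 := if_pos rfl
  have t2 (u : ℝ) : halfTurn l u (l + 1) = l + 1 / 2 + circleAt u / 2 := by simp [halfTurn]
  have t3 (u : ℝ) : halfTurn l u (l + 2) = (l + 2 : ℕ) := by simp [halfTurn]
  have t4 (u : ℝ) : halfTurn (l + 1) u l = l := by
    rw [halfTurn, if_neg (by omega), if_neg (by omega)]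
  have t5 (u : ℝ) : halfTurn (l + 1) u (l + 1) = (l + 1 : ℕ) + 1 / 2 - circleAt u / 2 := if_pos rfl
  have t6 (u : ℝ) : halfTurn (l + 1) u (l + 2) = (l + 1 : ℕ) + 1 / 2 + circleAt u / 2 := by
    simp [halfTurn]
  have s1 : swapAt l l = l + 1 := if_pos rfl
  have s2 : swapAt l (l + 1) = l := by simp [swapAt]
  have s3 : swapAt l (l + 2) = l + 2 := by simp [swapAt]
  have s4 : swapAt (l + 1) l = l := by rw [swapAt, if_neg (by omega), if_neg (by omega)]
  have s5 : swapAt (l + 1) (l + 1) = l + 2 := if_pos rfl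
  have s6 : swapAt (l + 1) (l + 2) = l + 1 := by simp [swapAt]
  have hw : rigidTurn l t b - rigidTurn l t a =
      ((if b = a + 2 then 2 else 1 : ℝ) : ℂ) * circleAt t := by
    rcases hab with ⟨rfl, rfl⟩ | ⟨rfl, rfl⟩ | ⟨rfl, rfl⟩ <;> simp [rigidTurn] <;> ring
  have hr : (0 : ℝ) < if b = a + 2 then 2 else 1 := by split_ifs <;> norm_num
  rw [hw]
  generalize (if b = a + 2 then 2 else 1 : ℝ) = r at hr
  have hR1 (u : ℝ) (h : t ≤ 3 / 4) := sameSide_right (norm_circleAt_half u) h0 h hr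
  have hR2 (u : ℝ) (h : t ≤ 3 / 4) := sameSide_right (norm_neg_circleAt_half u) h0 h hr
  have hL1 (u : ℝ) (h : 1 / 2 ≤ t) := sameSide_left (norm_circleAt_half u) h h1 hr
  have hL2 (u : ℝ) (h : 1 / 2 ≤ t) := sameSide_left (norm_neg_circleAt_half u) h h1 hr
  rcases le_or_gt t (1 / 2) with h | h
  · rw [tripleTurn_of_le h, tripleTurn_of_le h]
    have hU := sameSide_circleAt (u := 2 * t) (v := t) (abs_lt.2 ⟨by linarith, by linarith⟩) hr
    replace hR1 := hR1 (2 * t) (by linarith)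
    replace hR2 := hR2 (2 * t) (by linarith)
    rcases hik with ⟨h1, h2⟩ | ⟨h1, h2⟩ <;>
      rcases hab with ⟨h3, h4⟩ | ⟨h3, h4⟩ | ⟨h3, h4⟩ <;>
      simp only [h1, h3, h4, t1, t2, t3, t4, t5, t6]
    · convert hU using 1; ring
    · convert hR1 using 1; push_cast; ring
    · convert hR2 using 1; push_cast; ring
    · convert hR2 using 1; push_cast; ring
    · convert hR1 using 1; push_cast; ring
    · convert hU using 1; push_cast; ring
  rcases le_or_gt t (3 / 4) with h' | h'
  · rw [tripleTurn_of_mem h h', tripleTurn_of_mem h h']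
    have hU := sameSide_circleAt (u := 4 * t - 2) (v := t)
      (abs_lt.2 ⟨by linarith, by linarith⟩) hr
    replace hR1 := hR1 (4 * t - 2) (by linarith)
    replace hL1 := hL1 (4 * t - 2) (by linarith)
    rcases hik with ⟨h1, h2⟩ | ⟨h1, h2⟩ <;>
      rcases hab with ⟨h3, h4⟩ | ⟨h3, h4⟩ | ⟨h3, h4⟩ <;>
      simp only [h1, h2, h3, h4, s1, s2, s3, s4, s5, s6, t1, t2, t3, t4, t5, t6]
    · convert hL1 using 1; push_cast; ring
    · convert hU using 1; push_cast; ring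
    · convert hR1 using 1; push_cast; ring
    · convert hR1 using 1; push_cast; ring
    · convert hU using 1; ring
    · convert hL1 using 1; push_cast; ring
  · rw [tripleTurn_of_lt h', tripleTurn_of_lt h']
    have hU := sameSide_circleAt (u := 4 * t - 3) (v := t)
      (abs_lt.2 ⟨by linarith, by linarith⟩) hr
    replace hL1 := hL1 (4 * t - 3) (by linarith)
    replace hL2 := hL2 (4 * t - 3) (by linarith)
    rcases hik with ⟨h1, h2⟩ | ⟨h1, h2⟩ <;>
      rcases hab with ⟨h3, h4⟩ | ⟨h3, h4⟩ | ⟨h3, h4⟩ <;>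
      simp only [h1, h2, h3, h4, s1, s2, s3, s4, s5, s6, t1, t2, t3, t4, t5, t6]
    · convert hL2 using 1; push_cast; ring
    · convert hL1 using 1; push_cast; ring
    · convert hU using 1; ring
    · convert hU using 1; push_cast; ring
    · convert hL1 using 1; push_cast; ring
    · convert hL2 using 1; push_cast; ring

/-- Three half turns of neighbours are homotopic to the rigid half turn of three points. -/
theorem exists_homotopic_rigidTurn {n l : ℕ} (i k : Fin (n - 1))
    (hik : ((i : ℕ) = l ∧ (k : ℕ) = l + 1) ∨ ((i : ℕ) = l + 1 ∧ (k : ℕ) = l)) :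
    ∃ q : Path (baseConf n) (baseConf n), IsTrackOf (rigidTurn l) q ∧
      ((letterLoop (i, true)).trans
        ((letterLoop (k, true)).trans (letterLoop (i, true)))).Homotopic q := by
  refine (isTrackOf_tripleTurn i k).exists_homotopic (continuous_tripleTurn i k)
    (continuous_rigidTurn l) (fun j => ?_) (fun j => ?_)
    (staysIn_tripleTurn (l := l) (by omega) (by omega)) (staysIn_rigidTurn l)
    fun t ht a b hab hlo => sameSide_tripleTurn hik ?_ ht
  · rw [tripleTurn_zero, rigidTurn_zero]
  · rw [tripleTurn_one, rigidTurn_one]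
    congr 1
    unfold swapAt
    rcases hik with ⟨h1, h2⟩ | ⟨h1, h2⟩ <;> rw [h1, h2] <;> split_ifs <;> omega
  · split_ifs at hlo <;> omega

theorem letterLoop_braid {n : ℕ} (i k : Fin (n - 1)) (h : (i : ℕ) + 1 = k) :
    Path.Homotopic (((letterLoop (i, true)).trans
      ((letterLoop (k, true)).trans (letterLoop (i, true)))) : Path (baseConf n) (baseConf n))
      ((letterLoop (k, true)).trans ((letterLoop (i, true)).trans (letterLoop (k, true)))) := by
  obtain ⟨p, hp, hp'⟩ := exists_homotopic_rigidTurn (n := n) i k (Or.inl ⟨rfl, h.symm⟩)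
  obtain ⟨q, hq, hq'⟩ := exists_homotopic_rigidTurn (n := n) k i (Or.inr ⟨h.symm, rfl⟩)
  rw [hp.eq hq] at hp'
  exact hp'.trans hq'.symm

theorem letterLoop_comm {n : ℕ} (i k : Fin (n - 1)) (h : (i : ℕ) + 2 ≤ k) :
    Path.Homotopic ((letterLoop (i, true)).trans (letterLoop (k, true)) :
      Path (baseConf n) (baseConf n))
      ((letterLoop (k, true)).trans (letterLoop (i, true))) := by
  obtain ⟨p, hp, hp'⟩ := exists_homotopic_doubleTurn (n := n) i k (Or.inl h)
  obtain ⟨q, hq, hq'⟩ := exists_homotopic_doubleTurn (n := n) k i (Or.inr h)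
  rw [doubleTurn_comm (Or.inr h)] at hq
  rw [hp.eq hq] at hp'
  exact hp'.trans hq'.symm

/-! ### Closed braids as closures of loops. -/

/-- The change of time that gives the first of `N + 2` equal sectors to the first half of a
concatenation of two paths. -/
def sectorTime (N : ℕ) (t : unitInterval) : unitInterval :=
  -- The two linear pieces meet at t = 1/(N + 2) with value 1/2; the second is the less steep, so
  -- the minimum switches between them.
  ⟨min (t * (N + 2) / 2) (1 / 2 + (t * (N + 2) - 1) / (2 * (N + 1))), by
    have h0 := t.2.1
    have h1 := t.2.2
    have hN : (0 : ℝ) ≤ N := N.cast_nonneg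
    refine ⟨le_min (by positivity) ?_, (min_le_right _ _).trans ?_⟩
    · have : 1 / 2 + ((t : ℝ) * (N + 2) - 1) / (2 * (N + 1)) =
          (N + t * (N + 2)) / (2 * (N + 1)) := by
        field_simp
        ring
      rw [this]
      positivity
    · have : ((t : ℝ) * (N + 2) - 1) / (2 * (N + 1)) ≤ 1 / 2 := by
        rw [div_le_div_iff₀ (by positivity) (by norm_num)]
        nlinarith
      linarith⟩

theorem continuous_sectorTime (N : ℕ) : Continuous (sectorTime N) := by
  unfold sectorTime
  fun_prop

theorem sectorTime_zero (N : ℕ) : sectorTime N 0 = 0 := by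
  have hN : (0 : ℝ) ≤ N := N.cast_nonneg
  apply Subtype.ext
  simp only [sectorTime, Set.Icc.coe_zero]
  rw [min_eq_left]
  · simp
  · have : (1 / 2 : ℝ) + (0 * (N + 2) - 1) / (2 * (N + 1)) = N / (2 * (N + 1)) := by
      field_simp
      ring
    rw [this, zero_mul, zero_div]
    positivity

theorem sectorTime_one (N : ℕ) : sectorTime N 1 = 1 := by
  have hN : (0 : ℝ) ≤ N := N.cast_nonneg
  apply Subtype.ext
  simp only [sectorTime, Set.Icc.coe_one]
  have : (1 / 2 : ℝ) + (1 * (N + 2) - 1) / (2 * (N + 1)) = 1 := by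
    field_simp
    ring
  rw [this, min_eq_right]
  linarith

/-- The loop of configurations of a word. The turn is divided into equal sectors, one for each
letter, and one more in which the strings are at rest. -/
def wordLoop {n : ℕ} : BraidWord n → Path (baseConf n) (baseConf n)
  | [] => Path.refl _
  | x :: w => ((letterLoop x).trans (wordLoop w)).reparam (sectorTime w.length)
      (continuous_sectorTime _) (sectorTime_zero _) (sectorTime_one _)

theorem homotopic_wordLoop_cons {n : ℕ} (x : Fin (n - 1) × Bool) (w : BraidWord n) :
    Path.Homotopic (wordLoop (x :: w : BraidWord n)) ((letterLoop x).trans (wordLoop w)) :=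
  ⟨(Path.Homotopy.reparam _ _ (continuous_sectorTime _) (sectorTime_zero _)
    (sectorTime_one _)).symm⟩

/-- The index `k = w.length` is allowed: there `w[k]?` is `none`, which is the closing sector with
all strings at rest. -/
theorem wordLoop_apply {n : ℕ} (w : BraidWord n) : ∀ (k : ℕ) (u : ℝ), k ≤ w.length →
    u ∈ Set.Icc (0 : ℝ) 1 → ∀ t : unitInterval, (t : ℝ) = (k + u) / (w.length + 1) →
      wordLoop w t = Conf.mk (stringConf w[k]? u) := by
  induction w with
  | nil => exact fun k u hk hu t ht => rfl
  | cons x w ih =>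
    intro k u hk hu t ht
    have hN : (0 : ℝ) ≤ w.length := w.length.cast_nonneg
    have ht' : (t : ℝ) * (w.length + 2) = k + u := by
      rw [ht]
      simp only [List.length_cons]
      push_cast
      field_simp
      ring
    rw [wordLoop, Path.coe_reparam, Function.comp_apply, Path.trans_apply]
    have hs : (sectorTime w.length t : ℝ) =
        min ((k + u) / 2) (1 / 2 + (k + u - 1) / (2 * (w.length + 1))) := by
      simp only [sectorTime, ht']
    rcases k with _ | k
    · have hs0 : (sectorTime w.length t : ℝ) = u / 2 := by
        rw [hs, Nat.cast_zero, zero_add, min_eq_left]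
        have : (1 - u) / (2 * (w.length + 1 : ℝ)) ≤ (1 - u) / 2 :=
          div_le_div_of_nonneg_left (by linarith [hu.2]) (by norm_num) (by linarith)
        have h2 : (u - 1) / (2 * (w.length + 1 : ℝ)) = -((1 - u) / (2 * (w.length + 1 : ℝ))) := by
          ring
        linarith
      rw [dif_pos (by linarith [hu.2]), letterLoop_apply]
      congr 2
      simp only [hs0]
      ring
    · have hs1 : (sectorTime w.length t : ℝ) = 1 / 2 + (k + u) / (2 * (w.length + 1)) := by
        have h1 : ((k + 1 : ℕ) : ℝ) + u - 1 = k + u := by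
          push_cast
          ring
        rw [hs, h1, min_eq_right]
        have : (k + u) / (2 * (w.length + 1 : ℝ)) ≤ (k + u) / 2 :=
          div_le_div_of_nonneg_left (by linarith [hu.1, k.cast_nonneg (α := ℝ)]) (by norm_num)
            (by linarith)
        push_cast
        linarith
      have hk' : k ≤ w.length := by simpa using hk
      have hv (h : (2 * (sectorTime w.length t : ℝ) - 1) ∈ unitInterval) :
          wordLoop w ⟨2 * (sectorTime w.length t : ℝ) - 1, h⟩ = Conf.mk (stringConf w[k]? u) := by
        refine ih k u hk' hu _ ?_
        simp only [hs1]
        field_simp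
        ring
      rw [List.getElem?_cons_succ]
      -- The first half is possible only at the boundary time 1/2, where the end of the letter and
      -- the start of the remaining word agree at the base configuration.
      split_ifs with h
      · have h0 : (sectorTime w.length t : ℝ) = 1 / 2 := by
          refine le_antisymm h ?_
          rw [hs1]
          have : 0 ≤ (k + u) / (2 * (w.length + 1 : ℝ)) := by
            have := hu.1
            positivity
          linarith
        rw [← hv (by rw [h0]; norm_num)]
        have h1 : (⟨2 * (sectorTime w.length t : ℝ), by rw [h0]; norm_num⟩ : unitInterval) = 1 :=
          Subtype.ext (by simp [h0])
        have h2 : (⟨2 * (sectorTime w.length t : ℝ) - 1, by rw [h0]; norm_num⟩ : unitInterval) =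
          0 := Subtype.ext (by simp [h0])
        rw [h1, h2, Path.source, Path.target]
      · exact hv _

theorem closedBraid_eq_loopClosure {n : ℕ} (w : BraidWord n) :
    closedBraid w = loopClosure (wordLoop w) := by
  have hN : (0 : ℝ) < w.length + 1 := by positivity
  have key {k : ℕ} {u : ℝ} (hk : k ≤ w.length) (hu : u ∈ Set.Icc (0 : ℝ) 1)
      (ht : (k + u) / (w.length + 1 : ℝ) ∈ Set.Icc (0 : ℝ) 1) :
      ((wordLoop w).extend ((k + u) / (w.length + 1 : ℝ))).points =
        Set.range fun j : Fin n => stringPosition w[k]? j u := by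
    rw [Path.extend_apply _ ht, wordLoop_apply w k u hk hu _ rfl, Conf.points_mk]
    rfl
  ext x
  constructor
  · rintro ⟨k, hk, j, hj, u, hu, rfl⟩
    have ht : (k + u) / (w.length + 1 : ℝ) ∈ Set.Icc (0 : ℝ) 1 := by
      have hk' : (k : ℝ) ≤ w.length := Nat.cast_le.2 hk
      have := hu.1
      refine ⟨by positivity, (div_le_one hN).2 (by linarith [hu.2])⟩
    refine ⟨_, ht, stringPosition w[k]? j u, ?_, rfl⟩
    rw [key hk hu ht]
    exact ⟨⟨j, hj⟩, rfl⟩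
  · rintro ⟨t, ht, z, hz, rfl⟩
    obtain ⟨k, u, hk, hu, rfl⟩ : ∃ (k : ℕ) (u : ℝ), k ≤ w.length ∧ u ∈ Set.Icc (0 : ℝ) 1 ∧
        t = (k + u) / (w.length + 1) := by
      rcases ht.2.lt_or_eq with h | rfl
      · have h0 : 0 ≤ t * (w.length + 1) := mul_nonneg ht.1 hN.le
        refine ⟨⌊t * (w.length + 1)⌋₊, t * (w.length + 1) - ⌊t * (w.length + 1)⌋₊, ?_,
          ⟨by linarith [Nat.floor_le h0], by linarith [Nat.lt_floor_add_one (t * (w.length + 1))]⟩,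
          ?_⟩
        · refine Nat.lt_succ_iff.1 ((Nat.floor_lt h0).2 ?_)
          push_cast
          nlinarith
        · field_simp
          ring
      -- At t = 1 the floor would give a sector beyond the last one, so the end of the last sector
      -- is used.
      · exact ⟨w.length, 1, le_rfl, by simp, by field_simp⟩
    rw [key hk hu ht] at hz
    obtain ⟨j, rfl⟩ := hz
    exact ⟨k, hk, j, j.2, u, hu, rfl⟩

/-! ### The braid group acting through the fundamental group. -/

/-- The class of the loop of a generator in the fundamental group of the space of unordered
configurations. -/
def letterClass {n : ℕ} (i : Fin (n - 1)) : FundamentalGroup (Conf n) (baseConf n) :=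
  FundamentalGroup.fromPath (Path.Homotopic.Quotient.mk (letterLoop (i, true)))

theorem letterClass_braid {n : ℕ} (i k : Fin (n - 1)) (h : (i : ℕ) + 1 = k) :
    letterClass i * letterClass k * letterClass i =
      letterClass k * letterClass i * letterClass k :=
  Path.Homotopic.Quotient.eq.2 (letterLoop_braid i k h)

theorem letterClass_comm {n : ℕ} (i k : Fin (n - 1)) (h : (i : ℕ) + 2 ≤ k) :
    letterClass k * letterClass i = letterClass i * letterClass k :=
  Path.Homotopic.Quotient.eq.2 (letterLoop_comm i k h)

/-- The homomorphism from the braid group to the fundamental group of the space of unordered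
configurations. The opposite group appears since products in the fundamental group are written from
right to left. -/
def braidToLoops (n : ℕ) : BraidGroup n →* (FundamentalGroup (Conf n) (baseConf n))ᵐᵒᵖ :=
  PresentedGroup.toGroup (f := fun i => MulOpposite.op (letterClass i)) (by
    rintro r (⟨i, j, hij, rfl⟩ | ⟨i, j, hij, rfl⟩)
    · rw [map_mul, map_inv, mul_inv_eq_one]
      simp only [map_mul, FreeGroup.lift_apply_of, ← MulOpposite.op_mul]
      rw [← mul_assoc, ← mul_assoc, letterClass_braid i j hij]
    · rw [map_mul, map_inv, mul_inv_eq_one]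
      simp only [map_mul, FreeGroup.lift_apply_of, ← MulOpposite.op_mul]
      rw [letterClass_comm i j hij])

/-- Induction on the word: the sector times of `wordLoop` only reparametrise the concatenation of
loops, and an inverse letter is the reversed loop. Equal braids therefore have homotopic word loops.
-/
theorem braidToLoops_toBraid {n : ℕ} (w : BraidWord n) :
    braidToLoops n w.toBraid = MulOpposite.op
      (FundamentalGroup.fromPath (Path.Homotopic.Quotient.mk (wordLoop w))) := by
  have h : braidToLoops n w.toBraid = (w.map fun x => cond x.2 (MulOpposite.op (letterClass x.1))
      (MulOpposite.op (letterClass x.1))⁻¹).prod := by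
    rw [← FreeGroup.lift_mk (f := fun i => MulOpposite.op (letterClass i))]
    rfl
  rw [h]
  clear h
  induction w with
  | nil => rfl
  | cons x w ih =>
    have hx : cond x.2 (MulOpposite.op (letterClass x.1)) (MulOpposite.op (letterClass x.1))⁻¹ =
        MulOpposite.op
          (FundamentalGroup.fromPath (Path.Homotopic.Quotient.mk (letterLoop x))) := by
      obtain ⟨i, b⟩ := x
      cases b
      · rw [letterLoop_false]
        rfl
      · rfl
    rw [List.map_cons, List.prod_cons, ih, hx, ← MulOpposite.op_mul]
    exact congrArg MulOpposite.op
      (Path.Homotopic.Quotient.eq.2 (homotopic_wordLoop_cons x w)).symm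

theorem ambientIsotopic_closedBraid {n : ℕ} {w w' : BraidWord n} (h : w.toBraid = w'.toBraid) :
    AmbientIsotopic (closedBraid w) (closedBraid w') := by
  rw [closedBraid_eq_loopClosure, closedBraid_eq_loopClosure]
  have h1 := congrArg (braidToLoops n) h
  rw [braidToLoops_toBraid, braidToLoops_toBraid] at h1
  exact ambientIsotopic_of_homotopic (Path.Homotopic.Quotient.exact (MulOpposite.op_injective h1))

end

theorem mainTheorem1 :
    ∃ N M : ℕ, ∀ n μ : ℕ, N ≤ n → M ≤ μ →
      (closedBraidTypes n μ).Finite ∧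
      ((closedBraidTypes n μ).ncard : ℝ) <
        32 * Real.pi ^ 2 / Real.log 2 ^ 4 * ((2 : ℝ) ^ n / (n : ℝ) ^ 3) * (7 : ℝ) ^ (μ - 1) :=
  main_of_invariance fun _ _ _ h => ambientIsotopic_closedBraid h
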